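/- Let $(M,Q)$ be a simply connected complete $C^\infty$ Hermitian manifold which is reducible: there are $n\ge 2$ positive-dimensional complex manifolds with $C^\infty$ Hermitian metrics $(M_1,Q_1),\dots,(M_n,Q_n)$ and holomorphic projections $\pi_l:M\to M_l$ that identify $(M,Q)$, biholomorphically and isometrically, with the product $(M_1,Q_1)\times\cdots\times(M_n,Q_n)$ (for example, this is the de Rham decomposition of $(M,Q)$ into Hermitian factors). Write $Q_l(p,w)$ for the squared length of $w\in T^{1,0}_pM_l$. For $t\in[0,\infty)$ and an integer $k\ge 2$ define on $T^{1,0}M$ $$F_{t,k}(z,v)=\frac{1}{\sqrt{1+t}}\sqrt{\sum_{l=1}^n Q_l\big(\pi_l(z),(\pi_l)_*v\big)+t\,\Big(\sum_{l=1}^n Q_l\big(\pi_l(z),(\pi_l)_*v\big)^k\Big)^{1/k}} .$$ For a function $F$ on $T^{1,0}M$ put $G=F^2$; let $z^\alpha=x^\alpha+ix^{\alpha+N}$ be local holomorphic coordinates ($N=\dim_{\mathbb C}M$) and $v^\alpha=u^\alpha+iu^{\alpha+N}$ the fibre coordinates. $F$ is a strongly pseudoconvex complex Finsler metric if it is continuous,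 $F\ge 0$ with equality iff $v=0$, $G$ is $C^\infty$ for $v\neq0$, $G(z,\lambda v)=|\lambda|^2G(z,v)$ for $\lambda\in\mathbb C$, and $\big(G_{\alpha\bar\beta}\big)=\big(\partial^2G/\partial v^\alpha\partial\overline{v^\beta}\big)$ is positive definite for $v\ne0$; it is strongly convex if moreover $(g_{ab})=\big(\tfrac12\,\partial^2G/\partial u^a\partial u^b\big)$ is positive definite for $v\neq 0$. Let $\Gamma^\alpha_{\nu;\mu}=\partial_{v^\nu}\big(G^{\bar\tau\alpha}\,\partial^2G/\partial\overline{v^\tau}\partial z^\mu\big)$ and $2\mathbf G^b=G^{bc}\big(\tfrac{\partial^2G}{\partial u^c\partial x^a}u^a-\tfrac{\partial G}{\partial x^c}\big)$ with $(G^{bc})=\big(\partial^2G/\partial u^b\partial u^c\big)^{-1}$. A strongly pseudoconvex $F$ is complex Berwald if the $\Gamma^\alpha_{\nu;\mu}$ do not depend on $v$, Kähler-Finsler if $(\Gamma^\alpha_{\nu;\mu}-\Gamma^\alpha_{\mu;\nu})v^\nu=0$, and Kähler-Berwald if both hold. A strongly convex $F$ is real Berwald if $\partial^2\mathbf G^b/\partial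 u^a\partial u^c$ do not depend on $u$. $F$ is complete if each of its nonconstant geodesics (solutions of $\ddot\gamma+2\mathbf G(\gamma,\dot\gamma)=0$) extends to one defined on all of $\mathbb R$; completeness of $Q$ means completeness of $\sqrt Q$. The $\mathbf S$-curvature is the derivative along geodesics of $\log\big(\sqrt{\det(g_{ab})}/\sigma\big)$, where $\sigma$ is the Busemann-Hausdorff volume density of $F$. Then: (1) For all $t\ge0$ and integers $k\geq 2$, $F_{t,k}$ is a strongly convex complete complex Berwald metric on $M$; if $(M,Q)$ is Kähler, then $F_{t,k}$ is a Kähler-Berwald metric. Moreover, there are infinitely many metrics among the $F_{t,k}$. (2) For all $t\ge0$ and integers $k\ge2$, $F_{t,k}$ is a complete real Berwald metric on $M$, and its $\mathbf S$-curvature vanishes identically (at all nonzero tangent vectors). -/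

import Mathlib

open scoped Manifold ContDiff ComplexOrder
open Set

noncomputable section

namespace CFinsler

/-- The model vector space `ℂ^N`; a complex manifold of dimension `N` is a space with holomorphic
charts in it. -/
abbrev Cn (N : ℕ) : Type := Fin N → ℂ

/-! ### Partial derivatives in `ℂ^N` -/

/-- The vector `∂/∂x^a` of the real coordinates `x^1, …, x^{2N}`, where
`z^α = x^α + i x^{α+N}`; the index `α` is `Sum.inl α` and the index `α + N` is `Sum.inr α`. -/
def realBasis {N : ℕ} : Fin N ⊕ Fin N → Cn N
  | Sum.inl α => Pi.single α 1
  | Sum.inr α => Pi.single α Complex.I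

/-- The real partial derivative `∂f/∂x^a`. -/
def dReal {N : ℕ} (a : Fin N ⊕ Fin N) (f : Cn N → ℝ) (z : Cn N) : ℝ :=
  fderiv ℝ f z (realBasis a)

/-- The Wirtinger derivative `∂f/∂z^α`. -/
def dHol {N : ℕ} (α : Fin N) (f : Cn N → ℂ) (z : Cn N) : ℂ :=
  (fderiv ℝ f z (realBasis (Sum.inl α)) - Complex.I * fderiv ℝ f z (realBasis (Sum.inr α))) / 2

/-- The Wirtinger derivative `∂f/∂z̄^α`. -/
def dAnti {N : ℕ} (α : Fin N) (f : Cn N → ℂ) (z : Cn N) : ℂ :=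
  (fderiv ℝ f z (realBasis (Sum.inl α)) + Complex.I * fderiv ℝ f z (realBasis (Sum.inr α))) / 2

/-! ### Local complex objects attached to `G(z, v) = F(z, v)^2` -/

/-- The matrix `G_{α β̄} = ∂²G/∂v^α∂v̄^β`. -/
def leviMatrix {N : ℕ} (G : Cn N → Cn N → ℝ) (z v : Cn N) : Matrix (Fin N) (Fin N) ℂ :=
  Matrix.of fun α β => dHol α (dAnti β (fun w => (G z w : ℂ))) v

/-- The Chern-Finsler non-linear connection coefficients
`Γ^α_{;μ} = ∑_τ G^{τ̄ α} ∂²G/∂v̄^τ∂z^μ`. -/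
def chernFinslerNonlinear {N : ℕ} (G : Cn N → Cn N → ℝ) (α μ : Fin N) (z v : Cn N) : ℂ :=
  ∑ τ, (leviMatrix G z v)⁻¹ τ α * dHol μ (fun z' => dAnti τ (fun w => (G z' w : ℂ)) v) z

/-- The horizontal Chern-Finsler connection coefficients `Γ^α_{ν;μ} = ∂Γ^α_{;μ}/∂v^ν`. -/
def chernFinsler {N : ℕ} (G : Cn N → Cn N → ℝ) (α ν μ : Fin N) (z v : Cn N) : ℂ :=
  dHol ν (fun w => chernFinslerNonlinear G α μ z w) v

/-! ### Local real objects attached to `G(x, u) = F(x, u)^2` -/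

/-- The matrix `G_{ab} = ∂²G/∂u^a∂u^b`. -/
def realHessian {N : ℕ} (G : Cn N → Cn N → ℝ) (z v : Cn N) :
    Matrix (Fin N ⊕ Fin N) (Fin N ⊕ Fin N) ℝ :=
  Matrix.of fun a b => dReal a (dReal b (G z)) v

/-- The real fundamental tensor `g_{ab} = (1/2) ∂²G/∂u^a∂u^b`. -/
def fundamentalTensor {N : ℕ} (G : Cn N → Cn N → ℝ) (z v : Cn N) :
    Matrix (Fin N ⊕ Fin N) (Fin N ⊕ Fin N) ℝ :=
  (1 / 2 : ℝ) • realHessian G z v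

/-- The real geodesic spray coefficients `𝐆^b`, given by
`2 𝐆^b = ∑_c G^{bc} (∑_a ∂²G/∂u^c∂x^a u^a - ∂G/∂x^c)`. The inner sum over `a` is the derivative in
`x` in the direction `u`. -/
def sprayCoeff {N : ℕ} (G : Cn N → Cn N → ℝ) (b : Fin N ⊕ Fin N) (z v : Cn N) : ℝ :=
  (1 / 2) * ∑ c, (realHessian G z v)⁻¹ b c *
    (fderiv ℝ (fun z' => dReal c (G z') v) z v - dReal c (fun z' => G z' v) z)

/-- The vector of `ℂ^N` with real coordinates `2 𝐆^b`. -/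
def sprayVector {N : ℕ} (G : Cn N → Cn N → ℝ) (z v : Cn N) : Cn N :=
  ∑ b, (2 * sprayCoeff G b z v) • realBasis b

/-- The real Berwald connection coefficients `∂²𝐆^b/∂u^a∂u^c`. -/
def realBerwaldCoeff {N : ℕ} (G : Cn N → Cn N → ℝ) (b a c : Fin N ⊕ Fin N) (z v : Cn N) : ℝ :=
  dReal a (dReal c (fun w => sprayCoeff G b z w)) v

/-- The density of the Busemann-Hausdorff volume form in real coordinates: the volume of the
Euclidean unit ball of `ℝ^{2N}` divided by the volume of the unit ball of `F(x, ·)`. -/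
def busemannHausdorff {N : ℕ} (G : Cn N → Cn N → ℝ) (z : Cn N) : ℝ :=
  (MeasureTheory.volume {w : Cn N | ∑ i, ‖w i‖ ^ 2 < 1}).toReal /
    (MeasureTheory.volume {w : Cn N | G z w < 1}).toReal

/-- The distortion `τ = log (√(det g_{ab}(x, u)) / σ(x))`, where `σ` is the Busemann-Hausdorff
density. -/
def distortion {N : ℕ} (G : Cn N → Cn N → ℝ) (z v : Cn N) : ℝ :=
  Real.log (√(fundamentalTensor G z v).det / busemannHausdorff G z)

/-- The `S`-curvature: the rate of change of the distortion along geodesics, that is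
`u^a ∂τ/∂x^a - 2 𝐆^a ∂τ/∂u^a`. -/
def sCurvature {N : ℕ} (G : Cn N → Cn N → ℝ) (z v : Cn N) : ℝ :=
  fderiv ℝ (fun z' => distortion G z' v) z v - fderiv ℝ (distortion G z) v (sprayVector G z v)

/-! ### Finsler metrics on complex manifolds -/

section Manifold

variable (N : ℕ) (M : Type*) [TopologicalSpace M] [ChartedSpace (Cn N) M]

/-- Real valued functions on the holomorphic tangent bundle of `M`. The complex vector space
`T_p^{1,0} M` is the tangent space at `p` of the complex manifold `M`. -/
abbrev TangentFunction : Type _ := ∀ p : M, TangentSpace 𝓘(ℂ, Cn N) p → ℝ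

/-- A local holomorphic coordinate system of `M`. -/
def IsHolomorphicChart (e : OpenPartialHomeomorph M (Cn N)) : Prop :=
  e ∈ IsManifold.maximalAtlas 𝓘(ℂ, Cn N) ω M

variable {N M}

/-- The tangent vector `∑ v^α ∂/∂z^α` at the point with coordinates `z`. -/
def tangentVector (e : OpenPartialHomeomorph M (Cn N)) (z v : Cn N) :
    TangentSpace 𝓘(ℂ, Cn N) (e.symm z) :=
  mfderiv 𝓘(ℂ, Cn N) 𝓘(ℂ, Cn N) e.symm z v

/-- `F` in the coordinates `(z, v)` of the tangent bundle induced by the chart `e`. -/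
def localRep (F : TangentFunction N M) (e : OpenPartialHomeomorph M (Cn N)) (z v : Cn N) : ℝ :=
  F (e.symm z) (tangentVector e z v)

/-- `G = F^2` in the coordinates `(z, v)` of the tangent bundle induced by the chart `e`. -/
def localSq (F : TangentFunction N M) (e : OpenPartialHomeomorph M (Cn N)) (z v : Cn N) : ℝ :=
  localRep F e z v ^ 2

/-- Strongly pseudoconvex complex Finsler metrics. -/
structure IsStronglyPseudoconvex (F : TangentFunction N M) : Prop where
  continuous : ∀ e, IsHolomorphicChart N M e →
    ContinuousOn (fun x : Cn N × Cn N => localRep F e x.1 x.2) (e.target ×ˢ univ)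
  nonneg : ∀ p v, 0 ≤ F p v
  eq_zero_iff : ∀ p v, F p v = 0 ↔ v = 0
  smooth : ∀ e, IsHolomorphicChart N M e →
    ContDiffOn ℝ ∞ (fun x : Cn N × Cn N => localSq F e x.1 x.2) (e.target ×ˢ {0}ᶜ)
  homogeneous : ∀ p (c : ℂ) v, F p (c • v) ^ 2 = ‖c‖ ^ 2 * F p v ^ 2
  posDef : ∀ e, IsHolomorphicChart N M e → ∀ z ∈ e.target, ∀ v, v ≠ 0 →
    (leviMatrix (localSq F e) z v).PosDef

/-- Strongly convex complex Finsler metrics. -/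
structure IsStronglyConvex (F : TangentFunction N M) : Prop where
  stronglyPseudoconvex : IsStronglyPseudoconvex F
  posDef : ∀ e, IsHolomorphicChart N M e → ∀ z ∈ e.target, ∀ v, v ≠ 0 →
    (fundamentalTensor (localSq F e) z v).PosDef

/-- Complex Berwald metrics: the coefficients `Γ^α_{ν;μ}(z, v)` do not depend on `v`. -/
structure IsComplexBerwald (F : TangentFunction N M) : Prop where
  stronglyPseudoconvex : IsStronglyPseudoconvex F
  independent : ∀ e, IsHolomorphicChart N M e → ∀ z ∈ e.target, ∀ v w, v ≠ 0 → w ≠ 0 →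
    ∀ α ν μ, chernFinsler (localSq F e) α ν μ z v = chernFinsler (localSq F e) α ν μ z w

/-- Kähler-Finsler metrics: `(Γ^α_{ν;μ} - Γ^α_{μ;ν}) v^ν = 0`. -/
structure IsKahlerFinsler (F : TangentFunction N M) : Prop where
  stronglyPseudoconvex : IsStronglyPseudoconvex F
  torsion : ∀ e, IsHolomorphicChart N M e → ∀ z ∈ e.target, ∀ v, v ≠ 0 → ∀ α μ,
    ∑ ν, (chernFinsler (localSq F e) α ν μ z v - chernFinsler (localSq F e) α μ ν z v) * v ν = 0

/-- Kähler-Berwald metrics. -/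
def IsKahlerBerwald (F : TangentFunction N M) : Prop :=
  IsKahlerFinsler F ∧ IsComplexBerwald F

/-- Real Berwald metrics: the strongly convex metrics whose real Berwald connection coefficients
do not depend on the tangent vector. -/
structure IsRealBerwald (F : TangentFunction N M) : Prop where
  stronglyConvex : IsStronglyConvex F
  independent : ∀ e, IsHolomorphicChart N M e → ∀ z ∈ e.target, ∀ v w, v ≠ 0 → w ≠ 0 →
    ∀ b a c, realBerwaldCoeff (localSq F e) b a c z v = realBerwaldCoeff (localSq F e) b a c z w

/-- The `S`-curvature of `F` vanishes at all nonzero tangent vectors. -/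
def HasVanishingSCurvature (F : TangentFunction N M) : Prop :=
  ∀ e, IsHolomorphicChart N M e → ∀ z ∈ e.target, ∀ v, v ≠ 0 → sCurvature (localSq F e) z v = 0

/-- `γ` is a nonconstant geodesic of `F` on the open set `s` of parameters: in local coordinates,
`γ̈ + 2 𝐆(γ, γ̇) = 0`. -/
structure IsGeodesicOn (F : TangentFunction N M) (γ : ℝ → M) (s : Set ℝ) : Prop where
  continuousOn : ContinuousOn γ s
  smooth : ∀ e, IsHolomorphicChart N M e → ∀ r ∈ s, γ r ∈ e.source → ContDiffAt ℝ 2 (e ∘ γ) r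
  regular : ∀ e, IsHolomorphicChart N M e → ∀ r ∈ s, γ r ∈ e.source → deriv (e ∘ γ) r ≠ 0
  equation : ∀ e, IsHolomorphicChart N M e → ∀ r ∈ s, γ r ∈ e.source →
    deriv (deriv (e ∘ γ)) r + sprayVector (localSq F e) (e (γ r)) (deriv (e ∘ γ) r) = 0

/-- Completeness: every geodesic defined on an open interval extends to a geodesic defined on the
whole of `ℝ`. -/
def IsCompleteMetric (F : TangentFunction N M) : Prop :=
  ∀ (γ : ℝ → M) (s : Set ℝ), IsOpen s → s.OrdConnected → s.Nonempty → IsGeodesicOn F γ s →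
    ∃ γ' : ℝ → M, IsGeodesicOn F γ' univ ∧ EqOn γ' γ s

end Manifold

/-! ### Hermitian manifolds and their products -/

/-- `C^∞` Hermitian metrics on `M`. -/
structure HermitianMetric (N : ℕ) (M : Type*) [TopologicalSpace M] [ChartedSpace (Cn N) M] where
  /-- The Hermitian inner product on the tangent space at `p`. -/
  form : ∀ p : M, TangentSpace 𝓘(ℂ, Cn N) p →ₗ[ℂ] TangentSpace 𝓘(ℂ, Cn N) p →ₗ⋆[ℂ] ℂ
  conj_symm : ∀ p v w, star (form p v w) = form p w v
  pos : ∀ p v, v ≠ 0 → 0 < (form p v v).re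
  smooth : ∀ e, IsHolomorphicChart N M e → ∀ α β : Fin N, ContDiffOn ℝ ∞
    (fun z => form (e.symm z) (tangentVector e z (Pi.single α 1))
      (tangentVector e z (Pi.single β 1))) e.target

namespace HermitianMetric

variable {N : ℕ} {M : Type*} [TopologicalSpace M] [ChartedSpace (Cn N) M]

/-- The quadratic function `Q(p, v) = ⟨v, v⟩_p`. -/
def quad (Q : HermitianMetric N M) : TangentFunction N M := fun p v => (Q.form p v v).re

/-- The Hermitian metric `√Q` as a Finsler metric. -/
def norm (Q : HermitianMetric N M) : TangentFunction N M := fun p v => √(Q.quad p v)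

/-- The components `Q_{α β̄}(z)` in a chart. -/
def coeff (Q : HermitianMetric N M) (e : OpenPartialHomeomorph M (Cn N)) (α β : Fin N)
    (z : Cn N) : ℂ :=
  Q.form (e.symm z) (tangentVector e z (Pi.single α 1)) (tangentVector e z (Pi.single β 1))

/-- Kähler metrics: the fundamental form `i ∑ Q_{α β̄} dz^α ∧ dz̄^β` is closed, that is,
`∂Q_{α β̄}/∂z^μ = ∂Q_{μ β̄}/∂z^α` in all holomorphic coordinates. -/
def IsKahler (Q : HermitianMetric N M) : Prop :=
  ∀ e, IsHolomorphicChart N M e → ∀ z ∈ e.target, ∀ α β μ,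
    dHol μ (Q.coeff e α β) z = dHol α (Q.coeff e μ β) z

/-- Completeness of a Hermitian metric (of its underlying Riemannian metric). -/
def IsComplete (Q : HermitianMetric N M) : Prop := IsCompleteMetric Q.norm

end HermitianMetric

section Product

variable {n N : ℕ} {m : Fin n → ℕ}
  {M : Type*} [TopologicalSpace M] [ChartedSpace (Cn N) M]
  {X : Fin n → Type*} [∀ l, TopologicalSpace (X l)] [∀ l, ChartedSpace (Cn (m l)) (X l)]

/-- The push-forward `(π_l)_* v` of a tangent vector. -/
def pushforward (π : ∀ l, M → X l) (l : Fin n) (p : M) (v : TangentSpace 𝓘(ℂ, Cn N) p) :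
    TangentSpace 𝓘(ℂ, Cn (m l)) (π l p) :=
  mfderiv 𝓘(ℂ, Cn N) 𝓘(ℂ, Cn (m l)) (π l) p v

/-- The maps `π_l` are the projections of a decomposition
`(M, Q) = (X_1, Q_1) × ⋯ × (X_n, Q_n)` of Hermitian manifolds: together they form a biholomorphic
map of `M` onto the product (a holomorphic bijection with bijective differentials), and `Q` is the
product metric. -/
structure IsProductDecomposition (Q : HermitianMetric N M) (Ql : ∀ l, HermitianMetric (m l) (X l))
    (π : ∀ l, M → X l) : Prop where
  holomorphic : ∀ l, ContMDiff 𝓘(ℂ, Cn N) 𝓘(ℂ, Cn (m l)) ω (π l)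
  bijective : Function.Bijective fun (p : M) (l : Fin n) => π l p
  bijective_tangent : ∀ p : M, Function.Bijective
    fun (v : TangentSpace 𝓘(ℂ, Cn N) p) (l : Fin n) => pushforward (m := m) π l p v
  isometry : ∀ p v w, Q.form p v w =
    ∑ l, (Ql l).form (π l p) (pushforward π l p v) (pushforward π l p w)

/-- The function
`F_{t,k} = (1 + t)^{-1/2} √(∑_l Q_l + t (∑_l Q_l^k)^{1/k})`
on the tangent bundle of `M`, where `Q_l` is evaluated at `(π_l(z), (π_l)_* v)`. -/
def Ftk (Ql : ∀ l, HermitianMetric (m l) (X l)) (π : ∀ l, M → X l) (t : ℝ) (k : ℕ) :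
    TangentFunction N M := fun p v =>
  1 / √(1 + t) * √(∑ l, (Ql l).quad (π l p) (pushforward π l p v) +
    t * (∑ l, (Ql l).quad (π l p) (pushforward π l p v) ^ k) ^ (1 / (k : ℝ)))

end Product

end CFinsler

end

/-! In coordinates, `G = Φ (B z v v)`. The component `(B z v v)_l` is `Q_l` pulled back by the
projection to the `l`-th factor, and `Φ` is the function `powerGauge` of `n` nonnegative variables.
For the product metric `Q` itself, `Φ` is the sum of the coordinates (`sumGauge`). Everything rests
on one fact: for all admissible `Φ` (`IsGauge`) the spray and the Chern-Finsler connection are those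
of `Q`.

The reason is that both objects solve a linear system whose matrix is the Hessian of `G` (or its
(1,1)-part). For `Q` this system says that a sum over the factors vanishes. Testing it on vectors
tangent to one factor splits it into an identity in each component (`spray_component`,
`chern_component`). Applying `fderiv ℝ Φ` to these identities, and `fderiv ℝ (fderiv ℝ Φ)` to their
contraction with `v`, gives the system for `Φ` (`spray_gauge`, `chern_gauge`). Nondegeneracy of the
Hessian then makes the solutions equal.

Consequently the real and complex Berwald conditions, the Kähler condition and completeness are
inherited from `Q`, whose spray is quadratic in `v` and whose Chern connection does not depend on
`v`. Strong convexity is a Cauchy-Schwarz inequality for `powerGauge`.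

For the S-curvature, unit balls at different points are related by linear maps that preserve every
`Q_l`, so the Busemann-Hausdorff density is a constant multiple of the Riemannian density of `Q`
(`volume_mul_sqrt_metricDet`). Parallel transport of `Q` preserves each `Q_l`, hence also the ratio
of the determinants of the Hessians of `G` and `Q` (`sCurvature_eq_zero`). -/

noncomputable section

namespace CFinsler

open Filter Topology

/-! ### Derivatives of functions of a vector-valued quadratic form -/

section Calculus

variable {E W : Type*} [NormedAddCommGroup E] [NormedSpace ℝ E]
  [NormedAddCommGroup W] [NormedSpace ℝ W]

/-- The Hessian of `w ↦ Φ (B w w)` at `v`, for a symmetric bilinear map `B`. -/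
def hessForm (Φ : W → ℝ) (B : E →L[ℝ] E →L[ℝ] W) (v c d : E) : ℝ :=
  fderiv ℝ Φ (B v v) ((2 : ℝ) • B c d) +
    4 * fderiv ℝ (fderiv ℝ Φ) (B v v) (B v c) (B v d)

/-- The mixed derivative of `Φ (B z v v)`, where `B'` is the derivative of `B` in `z`. -/
def mixedForm (Φ : W → ℝ) (B B' : E →L[ℝ] E →L[ℝ] W) (v d : E) : ℝ :=
  fderiv ℝ Φ (B v v) ((2 : ℝ) • B' v d) +
    2 * fderiv ℝ (fderiv ℝ Φ) (B v v) (B' v v) (B v d)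

theorem hasFDerivAt_quad (B : E →L[ℝ] E →L[ℝ] W) (hB : ∀ v w, B v w = B w v) (v : E) :
    HasFDerivAt (fun w => B w w) ((2 : ℝ) • B v) v := by
  have h := (B.hasFDerivAt (x := v)).clm_apply (hasFDerivAt_id v)
  refine h.congr_fderiv ?_
  ext c
  simp [hB c v, two_smul]

theorem fderiv_comp_quad {Φ : W → ℝ} {B : E →L[ℝ] E →L[ℝ] W} (hB : ∀ v w, B v w = B w v) {v : E}
    (hΦ : DifferentiableAt ℝ Φ (B v v)) (c : E) :
    fderiv ℝ (fun w => Φ (B w w)) v c = fderiv ℝ Φ (B v v) ((2 : ℝ) • B v c) := by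
  have h : HasFDerivAt (fun w => Φ (B w w)) _ v :=
    HasFDerivAt.comp (f := fun w => B w w) v hΦ.hasFDerivAt (hasFDerivAt_quad B hB v)
  rw [h.fderiv]
  simp

theorem eventually_differentiableAt_comp {F : Type*} [TopologicalSpace F] {Φ : W → ℝ} {g : F → W}
    {x : F} (hg : ContinuousAt g x) (hΦ : ContDiffAt ℝ 2 Φ (g x)) :
    ∀ᶠ y in 𝓝 x, DifferentiableAt ℝ Φ (g y) := by
  have h : ∀ᶠ y in 𝓝 (g x), ContDiffAt ℝ 2 Φ y := hΦ.eventually (by simp)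
  filter_upwards [hg.eventually h] with y hy
  exact hy.differentiableAt (by norm_num)

theorem ContDiffAt.differentiableAt_fderiv {F : Type*} [NormedAddCommGroup F] [NormedSpace ℝ F]
    {Φ : W → F} {x : W} (hΦ : ContDiffAt ℝ 2 Φ x) : DifferentiableAt ℝ (fderiv ℝ Φ) x :=
  (hΦ.fderiv_right (m := 1) (by norm_num)).differentiableAt (by norm_num)

theorem hasFDerivAt_fderiv_comp_quad {Φ : W → ℝ} {B : E →L[ℝ] E →L[ℝ] W}
    (hB : ∀ v w, B v w = B w v) {v : E} (hΦ : ContDiffAt ℝ 2 Φ (B v v)) (d : E) :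
    ∃ L : E →L[ℝ] ℝ, HasFDerivAt (fun w => fderiv ℝ (fun w => Φ (B w w)) w d) L v ∧
      ∀ c, L c = hessForm Φ B v c d := by
  have hq := hasFDerivAt_quad B hB v
  have h1 : HasFDerivAt (fun w => fderiv ℝ Φ (B w w)) _ v :=
    HasFDerivAt.comp (f := fun w => B w w) v
      (ContDiffAt.differentiableAt_fderiv hΦ).hasFDerivAt hq
  have h2 : HasFDerivAt (fun w => (2 : ℝ) • B w d) ((2 : ℝ) • B.flip d) v :=
    ((B.flip d).hasFDerivAt (x := v)).const_smul (2 : ℝ)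
  refine ⟨_, (h1.clm_apply h2).congr_of_eventuallyEq ?_, fun c => ?_⟩
  · filter_upwards [eventually_differentiableAt_comp hq.continuousAt hΦ] with w hw
    exact fderiv_comp_quad hB hw d
  · simp [hessForm]
    ring

theorem fderiv_fderiv_comp_quad {Φ : W → ℝ} {B : E →L[ℝ] E →L[ℝ] W}
    (hB : ∀ v w, B v w = B w v) {v : E} (hΦ : ContDiffAt ℝ 2 Φ (B v v)) (c d : E) :
    fderiv ℝ (fun w => fderiv ℝ (fun w => Φ (B w w)) w d) v c = hessForm Φ B v c d := by
  obtain ⟨L, hL, h⟩ := hasFDerivAt_fderiv_comp_quad hB hΦ d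
  rw [hL.fderiv, h]

theorem hasFDerivAt_apply₂ {B : E → E →L[ℝ] E →L[ℝ] W} {z : E} (hB : DifferentiableAt ℝ B z)
    (v w : E) :
    HasFDerivAt (fun x => B x v w) (((fderiv ℝ B z).flip v).flip w) z := by
  have h := (hB.hasFDerivAt.clm_apply (hasFDerivAt_const v z)).clm_apply (hasFDerivAt_const w z)
  refine h.congr_fderiv ?_
  ext c
  simp

theorem fderiv_comp_quad_base {Φ : W → ℝ} {B : E → E →L[ℝ] E →L[ℝ] W} {z : E}
    (hd : DifferentiableAt ℝ B z) {v : E} (hΦ : DifferentiableAt ℝ Φ (B z v v)) (d : E) :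
    fderiv ℝ (fun x => Φ (B x v v)) z d = fderiv ℝ Φ (B z v v) (fderiv ℝ B z d v v) := by
  have h : HasFDerivAt (fun x => Φ (B x v v)) _ z :=
    HasFDerivAt.comp (f := fun x => B x v v) z hΦ.hasFDerivAt (hasFDerivAt_apply₂ hd v v)
  rw [h.fderiv]
  simp

theorem hasFDerivAt_mixed {Φ : W → ℝ} {B : E → E →L[ℝ] E →L[ℝ] W} {z : E}
    (hd : DifferentiableAt ℝ B z) (hB : ∀ᶠ x in 𝓝 z, ∀ v w, B x v w = B x w v) {v : E}
    (hΦ : ContDiffAt ℝ 2 Φ (B z v v)) (d : E) :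
    ∃ L : E →L[ℝ] ℝ, HasFDerivAt (fun x => fderiv ℝ (fun w => Φ (B x w w)) v d) L z ∧
      ∀ e, L e = mixedForm Φ (B z) (fderiv ℝ B z e) v d := by
  have hq := hasFDerivAt_apply₂ hd v v
  have h1 : HasFDerivAt (fun x => fderiv ℝ Φ (B x v v)) _ z :=
    HasFDerivAt.comp (f := fun x => B x v v) z
      (ContDiffAt.differentiableAt_fderiv hΦ).hasFDerivAt hq
  have h2 := (hasFDerivAt_apply₂ hd v d).const_smul (2 : ℝ)
  refine ⟨_, (h1.clm_apply h2).congr_of_eventuallyEq ?_, fun c => ?_⟩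
  · filter_upwards [eventually_differentiableAt_comp hq.continuousAt hΦ, hB] with x hx hs
    exact fderiv_comp_quad hs hx d
  · simp [mixedForm]

theorem fderiv_mixed {Φ : W → ℝ} {B : E → E →L[ℝ] E →L[ℝ] W} {z : E}
    (hd : DifferentiableAt ℝ B z) (hB : ∀ᶠ x in 𝓝 z, ∀ v w, B x v w = B x w v) {v : E}
    (hΦ : ContDiffAt ℝ 2 Φ (B z v v)) (d e : E) :
    fderiv ℝ (fun x => fderiv ℝ (fun w => Φ (B x w w)) v d) z e =
      mixedForm Φ (B z) (fderiv ℝ B z e) v d := by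
  obtain ⟨L, hL, h⟩ := hasFDerivAt_mixed hd hB hΦ d
  rw [hL.fderiv, h]

theorem hessForm_symm {Φ : W → ℝ} {B : E →L[ℝ] E →L[ℝ] W} (hB : ∀ v w, B v w = B w v) {v : E}
    (hΦ : ContDiffAt ℝ 2 Φ (B v v)) (c d : E) : hessForm Φ B v c d = hessForm Φ B v d c := by
  have h : IsSymmSndFDerivAt ℝ Φ (B v v) := hΦ.isSymmSndFDerivAt (by simp)
  rw [hessForm, hessForm, hB c d, h.eq]

theorem fderiv_symm {B : E → E →L[ℝ] E →L[ℝ] W} {z : E}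
    (hd : DifferentiableAt ℝ B z) (hB : ∀ᶠ x in 𝓝 z, ∀ v w, B x v w = B x w v) (e v w : E) :
    fderiv ℝ B z e v w = fderiv ℝ B z e w v := by
  have h1 := hasFDerivAt_apply₂ hd v w
  have h2 := hasFDerivAt_apply₂ hd w v
  have h := h1.unique (h2.congr_of_eventuallyEq (by filter_upwards [hB] with x hx using hx v w))
  simpa using DFunLike.congr_fun h e

end Calculus

/-! ### The real and complex Hessians in coordinates -/

section Coordinates

variable {N : ℕ} {W : Type*} [NormedAddCommGroup W] [NormedSpace ℝ W]

theorem I_smul_realBasis_inl (α : Fin N) :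
    Complex.I • (realBasis (Sum.inl α) : Cn N) = realBasis (Sum.inr α) := by
  ext i
  by_cases h : i = α
  · subst h; simp [realBasis]
  · simp [realBasis, h]

/-- The real number `φ d + i φ (i d)` attached to a real linear form. -/
def antilin (φ : Cn N → ℝ) (d : Cn N) : ℂ := φ d + Complex.I * φ (Complex.I • d)

theorem dAnti_ofReal {f : Cn N → ℝ} {v : Cn N} (hf : DifferentiableAt ℝ f v) (β : Fin N) :
    dAnti β (fun w => (f w : ℂ)) v = antilin (fderiv ℝ f v) (realBasis (Sum.inl β)) / 2 := by
  have h : HasFDerivAt (fun w => (f w : ℂ)) (Complex.ofRealCLM ∘L fderiv ℝ f v) v :=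
    Complex.ofRealCLM.hasFDerivAt.comp v hf.hasFDerivAt
  simp [dAnti, antilin, h.fderiv, I_smul_realBasis_inl]

/-- The family `φ` is arbitrary so that the formula serves both the fibre derivative in the Levi
matrix and the base derivative in `∂²G/∂v̄∂z`. The denominator 4 collects the factors 1/2 of the two
Wirtinger operators. -/
theorem dHol_antilin {φ : Cn N → Cn N → ℝ} {x d : Cn N} {L₁ L₂ : Cn N →L[ℝ] ℝ} (α : Fin N)
    (h₁ : HasFDerivAt (fun y => φ y d) L₁ x)
    (h₂ : HasFDerivAt (fun y => φ y (Complex.I • d)) L₂ x) :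
    dHol α (fun y => antilin (φ y) d / 2) x =
      ((L₁ (realBasis (Sum.inl α)) + L₂ (Complex.I • realBasis (Sum.inl α)) : ℝ) +
        Complex.I * (L₂ (realBasis (Sum.inl α)) -
          L₁ (Complex.I • realBasis (Sum.inl α)) : ℝ)) / 4 := by
  have k₁ : HasFDerivAt (fun y => (φ y d : ℂ)) (Complex.ofRealCLM ∘L L₁) x :=
    Complex.ofRealCLM.hasFDerivAt.comp x h₁
  have k₂ : HasFDerivAt (fun y => (φ y (Complex.I • d) : ℂ)) (Complex.ofRealCLM ∘L L₂) x :=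
    Complex.ofRealCLM.hasFDerivAt.comp x h₂
  have h : HasFDerivAt (fun y => antilin (φ y) d / 2)
      ((2 : ℂ)⁻¹ • (Complex.ofRealCLM ∘L L₁ + Complex.I • (Complex.ofRealCLM ∘L L₂))) x := by
    refine (((k₁.add (k₂.const_mul Complex.I)).const_mul (2 : ℂ)⁻¹)).congr_of_eventuallyEq ?_
    exact Eventually.of_forall fun y => by simp [antilin]; ring
  rw [dHol, h.fderiv, I_smul_realBasis_inl]
  simp
  linear_combination (-1 / 4 : ℂ) * L₂ (realBasis (Sum.inr α)) * Complex.I_sq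

end Coordinates

/-! ### The real coordinate basis and matrices of bilinear forms -/

section RealBasis

variable {N : ℕ}

/-- The real coordinates of a vector of `ℂ^N`. -/
def coordEquiv (N : ℕ) : Cn N ≃ₗ[ℝ] (Fin N ⊕ Fin N → ℝ) where
  toFun v := Sum.elim (fun α => (v α).re) (fun α => (v α).im)
  invFun x := fun α => ⟨x (Sum.inl α), x (Sum.inr α)⟩
  map_add' v w := by ext (α | α) <;> simp
  map_smul' c v := by ext (α | α) <;> simp
  left_inv v := by ext α; simp
  right_inv x := by ext (α | α) <;> simp

/-- The basis `∂/∂x^a` of the real vector space `ℂ^N`. -/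
def realBasisBasis (N : ℕ) : Module.Basis (Fin N ⊕ Fin N) ℝ (Cn N) :=
  Module.Basis.ofEquivFun (coordEquiv N)

@[simp]
theorem realBasisBasis_apply (a : Fin N ⊕ Fin N) : realBasisBasis N a = realBasis a := by
  rw [realBasisBasis, Module.Basis.coe_ofEquivFun]
  change (coordEquiv N).symm (Pi.single a 1) = _
  rw [LinearEquiv.symm_apply_eq]
  rcases a with α | α
  · ext (β | β) <;> by_cases h : β = α <;>
      simp [coordEquiv, realBasis, Pi.single_apply, h]
  · ext (β | β) <;> by_cases h : β = α <;>
      simp [coordEquiv, realBasis, Pi.single_apply, h]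

theorem sum_smul_realBasis_repr (v : Cn N) :
    ∑ a, (realBasisBasis N).repr v a • realBasis a = v := by
  simpa using (realBasisBasis N).sum_repr v

theorem linearMap_ext_realBasis {W : Type*} [AddCommGroup W] [Module ℝ W] {φ ψ : Cn N →ₗ[ℝ] W}
    (h : ∀ a, φ (realBasis a) = ψ (realBasis a)) : φ = ψ :=
  (realBasisBasis N).ext fun a => by simpa using h a

theorem sum_single_smul (c : Cn N) : ∑ α, c α • (realBasis (Sum.inl α) : Cn N) = c := by
  ext i
  simp [realBasis, Finset.sum_apply, Pi.single_apply]

/-- The `(1,1)`-part `4⁻¹ (A(c,d) + A(ic,id) + i (A(c,id) - A(ic,d)))` of a real bilinear form. -/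
def leviForm (A : Cn N →ₗ[ℝ] Cn N →ₗ[ℝ] ℝ) (c d : Cn N) : ℂ :=
  ((A c d + A (Complex.I • c) (Complex.I • d) : ℝ) +
    Complex.I * (A c (Complex.I • d) - A (Complex.I • c) d : ℝ)) / 4

theorem I_smul_I_smul (v : Cn N) : Complex.I • Complex.I • v = -v := by
  rw [smul_smul, Complex.I_mul_I, neg_one_smul]

theorem smul_eq_re_add_im (x : ℂ) (v : Cn N) : x • v = x.re • v + x.im • (Complex.I • v) := by
  ext i
  apply Complex.ext <;> simp
  ring

theorem leviForm_add_left (A : Cn N →ₗ[ℝ] Cn N →ₗ[ℝ] ℝ) (c c' d : Cn N) :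
    leviForm A (c + c') d = leviForm A c d + leviForm A c' d := by
  simp [leviForm, smul_add]
  ring

theorem leviForm_smul_left (A : Cn N →ₗ[ℝ] Cn N →ₗ[ℝ] ℝ) (x : ℂ) (c d : Cn N) :
    leviForm A (x • c) d = x * leviForm A c d := by
  have h : Complex.I • x • c = x.re • (Complex.I • c) + (-x.im) • c := by
    rw [smul_eq_re_add_im x c, smul_add, smul_comm Complex.I x.re, smul_comm Complex.I x.im,
      I_smul_I_smul, smul_neg, neg_smul]
  unfold leviForm
  rw [h, smul_eq_re_add_im x c]
  simp only [map_add, map_smul, LinearMap.add_apply, LinearMap.smul_apply, smul_eq_mul]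
  conv_rhs => rw [← Complex.re_add_im x]
  push_cast
  linear_combination (-(1 : ℂ) / 4) * x.im * (A c (Complex.I • d) - A (Complex.I • c) d) *
    Complex.I_sq

/-- Complex linearity in the first slot. It translates linear systems for the Levi matrix into
identities between forms. -/
theorem leviForm_sum_left (A : Cn N →ₗ[ℝ] Cn N →ₗ[ℝ] ℝ) (c d : Cn N) :
    ∑ α, c α * leviForm A (realBasis (Sum.inl α)) d = leviForm A c d := by
  let φ : Cn N →ₗ[ℂ] ℂ :=
    { toFun := fun c => leviForm A c d
      map_add' := fun c c' => leviForm_add_left A c c' d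
      map_smul' := fun x c => leviForm_smul_left A x c d }
  have h := congrArg φ (sum_single_smul c)
  rw [map_sum] at h
  simp only [map_smul, smul_eq_mul] at h
  exact h

theorem star_leviForm {A : Cn N →ₗ[ℝ] Cn N →ₗ[ℝ] ℝ} (hA : ∀ c d, A c d = A d c) (c d : Cn N) :
    star (leviForm A c d) = leviForm A d c := by
  simp [leviForm, hA d, hA (Complex.I • d)]
  ring

theorem leviForm_self {A : Cn N →ₗ[ℝ] Cn N →ₗ[ℝ] ℝ} (hA : ∀ c d, A c d = A d c) (c : Cn N) :
    leviForm A c c = ((A c c + A (Complex.I • c) (Complex.I • c)) / 4 : ℝ) := by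
  simp [leviForm, hA (Complex.I • c) c]

/-- On the diagonal the (1,1)-part is the average of `A` over `c` and `ic`, up to a factor 1/2; so
strong convexity implies strong pseudoconvexity. -/
theorem posDef_leviForm {A : Cn N →ₗ[ℝ] Cn N →ₗ[ℝ] ℝ} (hA : ∀ c d, A c d = A d c)
    (hpos : ∀ c, c ≠ 0 → 0 < A c c) :
    (Matrix.of fun α β : Fin N =>
      leviForm A (realBasis (Sum.inl α)) (realBasis (Sum.inl β))).PosDef := by
  refine Matrix.PosDef.of_dotProduct_mulVec_pos ?_ fun x hx => ?_
  · ext α β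
    simpa using star_leviForm hA _ _
  -- The argument is `star x` because `leviForm` is complex linear in its first slot, where the
  -- coefficients of `star x` stand.
  · have key : star x ⬝ᵥ (Matrix.of fun α β : Fin N =>
        leviForm A (realBasis (Sum.inl α)) (realBasis (Sum.inl β))).mulVec x =
        leviForm A (star x) (star x) := by
      have h1 : ∀ α : Fin N, (Matrix.of fun α β : Fin N =>
          leviForm A (realBasis (Sum.inl α)) (realBasis (Sum.inl β))).mulVec x α =
          leviForm A (realBasis (Sum.inl α)) (star x) := fun α => by
        rw [← star_leviForm hA, ← leviForm_sum_left]
        simp only [Matrix.mulVec, dotProduct, Matrix.of_apply, star_sum, star_mul']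
        exact Finset.sum_congr rfl fun β _ => by rw [star_leviForm hA]; simp [mul_comm]
      simp only [dotProduct, h1]
      exact leviForm_sum_left A (star x) (star x)
    rw [key, leviForm_self hA]
    have hx' : star x ≠ 0 := star_ne_zero.2 hx
    have hI : Complex.I • star x ≠ 0 := smul_ne_zero Complex.I_ne_zero hx'
    have := hpos _ hx'
    have := hpos _ hI
    rw [Complex.zero_lt_real]
    positivity

theorem posDef_toMatrix {A : LinearMap.BilinForm ℝ (Cn N)} (hA : ∀ c d, A c d = A d c)
    (hpos : ∀ c, c ≠ 0 → 0 < A c c) :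
    (LinearMap.BilinForm.toMatrix (realBasisBasis N) A).PosDef := by
  refine Matrix.PosDef.of_dotProduct_mulVec_pos ?_ fun x hx => ?_
  · ext a b
    simp [LinearMap.BilinForm.toMatrix_apply, hA]
  · rw [star_trivial, LinearMap.BilinForm.dotProduct_toMatrix_mulVec]
    exact hpos _ (by rwa [Ne, LinearEquiv.map_eq_zero_iff])

end RealBasis

/-! ### Gauges and split Hermitian forms -/

section Split

variable {n N : ℕ}

/-- Functions `Φ` of `n` nonnegative variables such that `Φ(|y_1|², …, |y_n|²)` is smooth and
strongly convex away from the origin. -/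
structure IsGauge (Φ : (Fin n → ℝ) → ℝ) : Prop where
  smooth : ∀ x, 0 ≤ x → x ≠ 0 → ContDiffAt ℝ ∞ Φ x
  pos : ∀ x y b, 0 ≤ x → x ≠ 0 → 0 ≤ y → y ≠ 0 →
    0 < fderiv ℝ Φ x y + 2 * fderiv ℝ (fderiv ℝ Φ) x b b

/-- The coordinate expression of the real parts of the Hermitian metrics of the factors of a
product. -/
structure IsSplitForm (U : Set (Cn N)) (B : Cn N → Cn N →L[ℝ] Cn N →L[ℝ] (Fin n → ℝ)) :
    Prop where
  isOpen : IsOpen U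
  smooth : ContDiffOn ℝ ∞ B U
  symm : ∀ z ∈ U, ∀ v w, B z v w = B z w v
  map_I : ∀ z ∈ U, ∀ v w, B z (Complex.I • v) (Complex.I • w) = B z v w
  nonneg : ∀ z ∈ U, ∀ v, 0 ≤ B z v v
  definite : ∀ z ∈ U, ∀ v, v ≠ 0 → B z v v ≠ 0
  split : ∀ z ∈ U, ∀ c l, ∃ d, B z (c - d) (c - d) l = 0 ∧ ∀ j, j ≠ l → B z d d j = 0
  fderiv_self : ∀ z ∈ U, ∀ v d l, B z d d l = 0 →
    2 * fderiv ℝ B z v v d l = fderiv ℝ B z d v v l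
  fderiv_I : ∀ z ∈ U, ∀ e v d l, B z d d l = 0 →
    fderiv ℝ B z e v d l + fderiv ℝ B z (Complex.I • e) v (Complex.I • d) l = 0
  isometric : ∀ z ∈ U, ∀ z' ∈ U, ∃ T : Cn N ≃ₗ[ℝ] Cn N, ∀ w, B z' (T w) (T w) = B z w w

/-- The Hessian of `w ↦ Φ (B w w)` as a bilinear form. -/
def hessBilin (Φ : (Fin n → ℝ) → ℝ) (B : Cn N →L[ℝ] Cn N →L[ℝ] (Fin n → ℝ)) (v : Cn N) :
    Cn N →ₗ[ℝ] Cn N →ₗ[ℝ] ℝ :=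
  LinearMap.mk₂ ℝ (hessForm Φ B v)
    (fun c c' d => by simp only [hessForm, map_add, add_apply, smul_add]; ring)
    (fun r c d => by
      simp only [hessForm, map_smul, smul_apply, smul_eq_mul]; ring)
    (fun c d d' => by simp only [hessForm, map_add, smul_add]; ring)
    (fun r c d => by simp only [hessForm, map_smul, smul_eq_mul]; ring)

@[simp]
theorem hessBilin_apply (Φ : (Fin n → ℝ) → ℝ) (B : Cn N →L[ℝ] Cn N →L[ℝ] (Fin n → ℝ))
    (v c d : Cn N) : hessBilin Φ B v c d = hessForm Φ B v c d := rfl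

namespace IsSplitForm

variable {U : Set (Cn N)} {B : Cn N → Cn N →L[ℝ] Cn N →L[ℝ] (Fin n → ℝ)} (hB : IsSplitForm U B)
  {Φ : (Fin n → ℝ) → ℝ} (hΦ : IsGauge Φ) {z v : Cn N} (hz : z ∈ U) (hv : v ≠ 0)

include hB hz

theorem contDiffAt : ContDiffAt ℝ ∞ B z := hB.smooth.contDiffAt (hB.isOpen.mem_nhds hz)

theorem differentiableAt : DifferentiableAt ℝ B z :=
  (hB.contDiffAt hz).differentiableAt (by simp)

theorem eventually_symm : ∀ᶠ x in 𝓝 z, ∀ v w, B x v w = B x w v := by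
  filter_upwards [hB.isOpen.mem_nhds hz] with x hx using hB.symm x hx

theorem fderiv_symm (e v w : Cn N) : fderiv ℝ B z e v w = fderiv ℝ B z e w v :=
  CFinsler.fderiv_symm (hB.differentiableAt hz) (hB.eventually_symm hz) e v w

theorem fderiv_map_I (e v w : Cn N) :
    fderiv ℝ B z e (Complex.I • v) (Complex.I • w) = fderiv ℝ B z e v w := by
  have h1 := hasFDerivAt_apply₂ (hB.differentiableAt hz) v w
  have h2 := hasFDerivAt_apply₂ (hB.differentiableAt hz) (Complex.I • v) (Complex.I • w)
  have h := h2.unique (h1.congr_of_eventuallyEq (by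
    filter_upwards [hB.isOpen.mem_nhds hz] with x hx using hB.map_I x hx v w))
  simpa using DFunLike.congr_fun h e

/-- Cauchy-Schwarz for a component that is only semidefinite, from the discriminant of `r ↦ B z (v +
r w) (v + r w) l`. -/
theorem sq_le (v w : Cn N) (l : Fin n) : B z v w l ^ 2 ≤ B z v v l * B z w w l := by
  have h : ∀ r : ℝ, 0 ≤ B z w w l * (r * r) + 2 * B z v w l * r + B z v v l := fun r => by
    have := hB.nonneg z hz (v + r • w) l
    simp only [map_add, map_smul, add_apply, smul_apply,
      hB.symm z hz w v, Pi.add_apply, Pi.smul_apply, smul_eq_mul, Pi.zero_apply] at this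
    linarith
  have := discrim_le_zero h
  rw [discrim] at this
  linarith

theorem apply_eq_zero {d : Cn N} {l : Fin n} (hd : B z d d l = 0) (v : Cn N) :
    B z v d l = 0 := by
  have := hB.sq_le hz v d l
  rw [hd, mul_zero] at this
  exact pow_eq_zero_iff two_ne_zero |>.1 (le_antisymm this (sq_nonneg _))

theorem apply_I_right (v w : Cn N) : B z v (Complex.I • w) = -B z (Complex.I • v) w := by
  have h := hB.map_I z hz v (Complex.I • w)
  rw [I_smul_I_smul, map_neg] at h
  exact h.symm

theorem fderiv_apply_I_right (e v w : Cn N) :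
    fderiv ℝ B z e v (Complex.I • w) = -fderiv ℝ B z e (Complex.I • v) w := by
  have h := hB.fderiv_map_I hz e v (Complex.I • w)
  rw [I_smul_I_smul, map_neg] at h
  exact h.symm

theorem fderiv_apply_I_self (e v : Cn N) : fderiv ℝ B z e v (Complex.I • v) = 0 := by
  have h := hB.fderiv_apply_I_right hz e v v
  rw [hB.fderiv_symm hz e (Complex.I • v)] at h
  exact self_eq_neg.1 h

/-- Splits an identity summed over the factors into its components. Let `d` be the part of `c`
tangent to the factor `l`: passing from `c` to `d` does not change the component `l` of `φ`, and all
other components of `φ d` vanish, so the component `l` is the whole sum. -/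
theorem eq_zero_of_sum_eq_zero {φ : Cn N → Fin n → ℝ} (hsub : ∀ c d, φ (c - d) = φ c - φ d)
    (h0 : ∀ d l, B z d d l = 0 → φ d l = 0) (hsum : ∀ d, ∑ l, φ d l = 0) (c : Cn N) :
    φ c = 0 := by
  ext l
  obtain ⟨d, hd, hd'⟩ := hB.split z hz c l
  have h1 := h0 _ _ hd
  have h2 : φ d l = 0 := by
    rw [← hsum d, Finset.sum_eq_single l (fun j _ hj => h0 d j (hd' j hj)) (by simp)]
  rw [hsub, Pi.sub_apply, h2, sub_zero] at h1
  exact h1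

include hΦ hv

theorem contDiffAt_gauge : ContDiffAt ℝ ∞ Φ (B z v v) :=
  hΦ.smooth _ (hB.nonneg z hz v) (hB.definite z hz v hv)

theorem contDiffAt_two_gauge : ContDiffAt ℝ 2 Φ (B z v v) :=
  (hB.contDiffAt_gauge hΦ hz hv).of_le (by norm_cast)

/-- The Hessian on the diagonal is twice the expression in `IsGauge.pos` with `y = B z c c` and `b =
B z v c`. -/
theorem hessForm_pos {c : Cn N} (hc : c ≠ 0) : 0 < hessForm Φ (B z) v c c := by
  have := hΦ.pos (B z v v) (B z c c) (B z v c) (hB.nonneg z hz v) (hB.definite z hz v hv)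
    (hB.nonneg z hz c) (hB.definite z hz c hc)
  rw [hessForm, map_smul, smul_eq_mul]
  linarith

theorem hessBilin_symm (c d : Cn N) : hessBilin Φ (B z) v c d = hessBilin Φ (B z) v d c :=
  hessForm_symm (hB.symm z hz) (hB.contDiffAt_two_gauge hΦ hz hv) c d

theorem realHessian_eq : realHessian (fun z w => Φ (B z w w)) z v =
    LinearMap.BilinForm.toMatrix (realBasisBasis N) (hessBilin Φ (B z) v) := by
  ext a b
  rw [LinearMap.BilinForm.toMatrix_apply, realBasisBasis_apply, realBasisBasis_apply]
  exact fderiv_fderiv_comp_quad (hB.symm z hz) (hB.contDiffAt_two_gauge hΦ hz hv) _ _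

theorem posDef_realHessian : (realHessian (fun z w => Φ (B z w w)) z v).PosDef := by
  rw [hB.realHessian_eq hΦ hz hv]
  exact posDef_toMatrix (hB.hessBilin_symm hΦ hz hv) fun c hc => hB.hessForm_pos hΦ hz hv hc

theorem posDef_fundamentalTensor :
    (fundamentalTensor (fun z w => Φ (B z w w)) z v).PosDef :=
  (hB.posDef_realHessian hΦ hz hv).smul (by norm_num)

theorem leviMatrix_eq : leviMatrix (fun z w => Φ (B z w w)) z v =
    Matrix.of fun α β => leviForm (hessBilin Φ (B z) v)
      (realBasis (Sum.inl α)) (realBasis (Sum.inl β)) := by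
  ext α β
  have h2 := hB.contDiffAt_two_gauge hΦ hz hv
  obtain ⟨L₁, hL₁, h₁⟩ := hasFDerivAt_fderiv_comp_quad (hB.symm z hz) h2
    (realBasis (Sum.inl β))
  obtain ⟨L₂, hL₂, h₂⟩ := hasFDerivAt_fderiv_comp_quad (hB.symm z hz) h2
    (Complex.I • realBasis (Sum.inl β))
  have hd : dAnti β (fun w => (Φ (B z w w) : ℂ)) =ᶠ[𝓝 v] fun w =>
      antilin (fderiv ℝ (fun w => Φ (B z w w)) w) (realBasis (Sum.inl β)) / 2 := by
    have hq := hasFDerivAt_quad (B z) (hB.symm z hz) v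
    filter_upwards [eventually_differentiableAt_comp hq.continuousAt h2] with w hw
    exact dAnti_ofReal (DifferentiableAt.comp (f := fun w => B z w w) w hw
      (hasFDerivAt_quad (B z) (hB.symm z hz) w).differentiableAt) β
  rw [leviMatrix, Matrix.of_apply, dHol, hd.fderiv_eq, ← dHol,
    dHol_antilin (φ := fun w => ⇑(fderiv ℝ (fun w => Φ (B z w w)) w)) α hL₁ hL₂]
  simp [leviForm, h₁, h₂]

theorem posDef_leviMatrix : (leviMatrix (fun z w => Φ (B z w w)) z v).PosDef := by
  rw [hB.leviMatrix_eq hΦ hz hv]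
  exact posDef_leviForm (hB.hessBilin_symm hΦ hz hv) fun c hc => hB.hessForm_pos hΦ hz hv hc

end IsSplitForm

end Split

/-! ### Independence of the spray and of the Chern-Finsler connection from the gauge. -/

section Connection

variable {n N : ℕ}

/-- The gauge `x ↦ ∑ x_l`. -/
def sumGauge (n : ℕ) : (Fin n → ℝ) →L[ℝ] ℝ := ∑ l, ContinuousLinearMap.proj l

@[simp]
theorem sumGauge_apply (x : Fin n → ℝ) : sumGauge n x = ∑ l, x l := by
  simp [sumGauge]

@[simp]
theorem fderiv_fderiv_sumGauge (x : Fin n → ℝ) : fderiv ℝ (fderiv ℝ (sumGauge n)) x = 0 := by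
  have h : fderiv ℝ (sumGauge n) = fun _ => sumGauge n := by
    funext x
    exact (sumGauge n).fderiv
  rw [h]
  exact fderiv_const_apply _

theorem isGauge_sumGauge : IsGauge (sumGauge n) where
  smooth x _ _ := (sumGauge n).contDiff.contDiffAt
  pos x y b _ _ hy hy' := by
    rw [ContinuousLinearMap.fderiv, fderiv_fderiv_sumGauge]
    simp only [sumGauge_apply, zero_apply, mul_zero, add_zero]
    obtain ⟨l, hl⟩ := Function.ne_iff.1 hy'
    exact Finset.sum_pos' (fun l _ => hy l)
      ⟨l, Finset.mem_univ l, lt_of_le_of_ne (hy l) (Ne.symm hl)⟩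

@[simp]
theorem hessForm_sumGauge (B : Cn N →L[ℝ] Cn N →L[ℝ] (Fin n → ℝ)) (v c d : Cn N) :
    hessForm (sumGauge n) B v c d = 2 * ∑ l, B c d l := by
  simp [hessForm, Finset.mul_sum]

@[simp]
theorem mixedForm_sumGauge (B B' : Cn N →L[ℝ] Cn N →L[ℝ] (Fin n → ℝ)) (v d : Cn N) :
    mixedForm (sumGauge n) B B' v d = 2 * ∑ l, B' v d l := by
  simp [mixedForm, Finset.mul_sum]

/-- The right hand side of the equation for the geodesic spray. -/
def sprayForm (Φ : (Fin n → ℝ) → ℝ) (B : Cn N →L[ℝ] Cn N →L[ℝ] (Fin n → ℝ))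
    (B' : Cn N →L[ℝ] Cn N →L[ℝ] Cn N →L[ℝ] (Fin n → ℝ)) (v d : Cn N) : ℝ :=
  mixedForm Φ B (B' v) v d - fderiv ℝ Φ (B v v) (B' d v v)

/-- The right hand side of the equation for the Chern-Finsler connection. -/
def mixedLeviForm (Φ : (Fin n → ℝ) → ℝ) (B : Cn N →L[ℝ] Cn N →L[ℝ] (Fin n → ℝ))
    (B' : Cn N →L[ℝ] Cn N →L[ℝ] Cn N →L[ℝ] (Fin n → ℝ)) (e v d : Cn N) : ℂ :=
  ((mixedForm Φ B (B' e) v d + mixedForm Φ B (B' (Complex.I • e)) v (Complex.I • d) : ℝ) +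
    Complex.I * (mixedForm Φ B (B' e) v (Complex.I • d) -
      mixedForm Φ B (B' (Complex.I • e)) v d : ℝ)) / 4

theorem eq_and_eq_of_ofReal_add_I_mul {a b c d : ℝ}
    (h : ((a : ℂ) + Complex.I * b) / 4 = ((c : ℂ) + Complex.I * d) / 4) : a = c ∧ b = d := by
  have h' := (div_left_inj' (by norm_num : (4 : ℂ) ≠ 0)).1 h
  exact ⟨by simpa using congrArg Complex.re h', by simpa using congrArg Complex.im h'⟩

namespace IsSplitForm

variable {U : Set (Cn N)} {B : Cn N → Cn N →L[ℝ] Cn N →L[ℝ] (Fin n → ℝ)} (hB : IsSplitForm U B)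
  {Φ : (Fin n → ℝ) → ℝ} (hΦ : IsGauge Φ) {z v : Cn N} (hz : z ∈ U) (hv : v ≠ 0)

include hB hz

theorem sprayForm_eq (h2 : ContDiffAt ℝ 2 Φ (B z v v)) (d : Cn N) :
    fderiv ℝ (fun x => fderiv ℝ (fun w => Φ (B x w w)) v d) z v -
      fderiv ℝ (fun x => Φ (B x v v)) z d = sprayForm Φ (B z) (fderiv ℝ B z) v d := by
  rw [fderiv_mixed (hB.differentiableAt hz) (hB.eventually_symm hz) h2,
    fderiv_comp_quad_base (hB.differentiableAt hz) (h2.differentiableAt (by norm_num)), sprayForm]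

theorem mixedLeviForm_eq (h2 : ContDiffAt ℝ 2 Φ (B z v v)) (μ τ : Fin N) :
    dHol μ (fun z' => dAnti τ (fun w => (Φ (B z' w w) : ℂ)) v) z =
      mixedLeviForm Φ (B z) (fderiv ℝ B z) (realBasis (Sum.inl μ)) v
        (realBasis (Sum.inl τ)) := by
  have hd := hB.differentiableAt hz
  obtain ⟨L₁, hL₁, h₁⟩ := hasFDerivAt_mixed hd (hB.eventually_symm hz) h2
    (realBasis (Sum.inl τ))
  obtain ⟨L₂, hL₂, h₂⟩ := hasFDerivAt_mixed hd (hB.eventually_symm hz) h2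
    (Complex.I • realBasis (Sum.inl τ))
  have he : (fun z' => dAnti τ (fun w => (Φ (B z' w w) : ℂ)) v) =ᶠ[𝓝 z] fun x =>
      antilin (fderiv ℝ (fun w => Φ (B x w w)) v) (realBasis (Sum.inl τ)) / 2 := by
    filter_upwards [eventually_differentiableAt_comp (hasFDerivAt_apply₂ hd v v).continuousAt h2,
      hB.eventually_symm hz] with x hx hs
    exact dAnti_ofReal (DifferentiableAt.comp (f := fun w => B x w w) v hx
      (hasFDerivAt_quad (B x) hs v).differentiableAt) τ
  rw [dHol, he.fderiv_eq, ← dHol,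
    dHol_antilin (φ := fun x => ⇑(fderiv ℝ (fun w => Φ (B x w w)) v)) μ hL₁ hL₂]
  simp only [mixedLeviForm, h₁, h₂]

/-- The hypothesis is the summed identity. If `d` is null for the component `l`, then `B z s d l`
vanishes and the two terms on the right cancel by `fderiv_self`, so `eq_zero_of_sum_eq_zero`
applies. -/
theorem spray_component {s : Cn N}
    (hs : ∀ d, hessForm (sumGauge n) (B z) v s d =
      sprayForm (sumGauge n) (B z) (fderiv ℝ B z) v d) (d : Cn N) :
    (2 : ℝ) • B z s d = (2 : ℝ) • fderiv ℝ B z v v d - fderiv ℝ B z d v v := by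
  rw [← sub_eq_zero]
  refine hB.eq_zero_of_sum_eq_zero hz (φ := fun d =>
    (2 : ℝ) • B z s d - ((2 : ℝ) • fderiv ℝ B z v v d - fderiv ℝ B z d v v)) ?_ ?_ ?_ d
  · intro c d
    simp only [map_sub, sub_apply, smul_sub]
    abel
  · intro d l hd
    have h1 := hB.fderiv_self z hz v d l hd
    have h2 := hB.apply_eq_zero hz hd s
    simp [h1, h2]
  · intro d
    have h := hs d
    simp only [sprayForm, hessForm_sumGauge, mixedForm_sumGauge, ContinuousLinearMap.fderiv,
      sumGauge_apply] at h
    simp only [Pi.sub_apply, Pi.smul_apply, smul_eq_mul, Finset.sum_sub_distrib,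
      ← Finset.mul_sum]
    linarith

/-- The first-order terms in `Φ` agree by `spray_component` at `d`. At `d = v` the same identity
reads `B'_v(v,v) = 2 B(v,s)`, which matches the second-order terms. -/
theorem spray_gauge {s : Cn N}
    (hs : ∀ d, hessForm (sumGauge n) (B z) v s d =
      sprayForm (sumGauge n) (B z) (fderiv ℝ B z) v d) (d : Cn N) :
    hessForm Φ (B z) v s d = sprayForm Φ (B z) (fderiv ℝ B z) v d := by
  have h1 := hB.spray_component hz hs d
  have h2 := hB.spray_component hz hs v
  rw [two_smul ℝ (fderiv ℝ B z v v v), add_sub_cancel_right] at h2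
  have h3 : fderiv ℝ B z v v v = (2 : ℝ) • B z v s := by rw [← h2, hB.symm z hz]
  simp only [hessForm, sprayForm, mixedForm]
  rw [h3, h1]
  simp only [map_sub, map_smul, smul_apply, smul_eq_mul]
  ring

/-- The complex counterpart of `spray_component`, with `fderiv_I` in the place of `fderiv_self`. -/
theorem chern_component {s e : Cn N}
    (hs : ∀ τ, leviForm (hessBilin (sumGauge n) (B z) v) s (realBasis (Sum.inl τ)) =
      mixedLeviForm (sumGauge n) (B z) (fderiv ℝ B z) e v (realBasis (Sum.inl τ)))
    (d : Cn N) :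
    (2 : ℝ) • B z s d = fderiv ℝ B z e v d +
      fderiv ℝ B z (Complex.I • e) v (Complex.I • d) := by
  let J : Cn N →L[ℝ] Cn N := Complex.I • ContinuousLinearMap.id ℝ (Cn N)
  let φ : Cn N →L[ℝ] (Fin n → ℝ) := (2 : ℝ) • B z s -
    (fderiv ℝ B z e v + (fderiv ℝ B z (Complex.I • e) v).comp J)
  have hφ : ∀ d, φ d = (2 : ℝ) • B z s d - (fderiv ℝ B z e v d +
      fderiv ℝ B z (Complex.I • e) v (Complex.I • d)) := fun d => rfl
  rw [← sub_eq_zero, ← hφ]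
  refine hB.eq_zero_of_sum_eq_zero hz (φ := φ) (map_sub φ) ?_ ?_ d
  · intro d l hd
    have h1 := hB.fderiv_I z hz e v d l hd
    have h2 := hB.apply_eq_zero hz hd s
    rw [hφ, Pi.sub_apply, Pi.add_apply, h1, Pi.smul_apply, h2]
    simp
  -- The real part of the hypothesis at `∂/∂x^τ` gives the summed identity there, and the imaginary
  -- part gives it at `i ∂/∂x^τ`. Together these vectors form a real basis.
  · have key : (sumGauge n).comp φ = 0 := by
      apply ContinuousLinearMap.coe_injective
      apply linearMap_ext_realBasis
      intro a
      simp only [ContinuousLinearMap.coe_coe, ContinuousLinearMap.comp_apply, sumGauge_apply, hφ]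
      rcases a with τ | τ
      · have h := (eq_and_eq_of_ofReal_add_I_mul (hs τ)).1
        simp only [hessBilin_apply, hessForm_sumGauge, mixedForm_sumGauge, hB.map_I z hz] at h
        simp only [Pi.sub_apply, Pi.add_apply, Pi.smul_apply, smul_eq_mul,
          Finset.sum_sub_distrib, Finset.sum_add_distrib, ← Finset.mul_sum,
          zero_apply]
        linarith
      · have h := (eq_and_eq_of_ofReal_add_I_mul (hs τ)).2
        have h4 : B z (Complex.I • s) (realBasis (Sum.inl τ)) =
            -B z s (Complex.I • realBasis (Sum.inl τ)) := by
          rw [hB.apply_I_right hz, neg_neg]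
        simp only [hessBilin_apply, hessForm_sumGauge, mixedForm_sumGauge, h4, Pi.neg_apply,
          Finset.sum_neg_distrib] at h
        rw [← I_smul_realBasis_inl, I_smul_I_smul, map_neg]
        simp only [Pi.sub_apply, Pi.add_apply, Pi.smul_apply, smul_eq_mul, Pi.neg_apply,
          Finset.sum_sub_distrib, Finset.sum_add_distrib, ← Finset.mul_sum,
          Finset.sum_neg_distrib, zero_apply]
        linarith
    intro d
    simpa using DFunLike.congr_fun key d

/-- As in `spray_gauge`, with the component identity tested at `v` and at `iv`. The cross terms
there vanish because the derivative of `B` is zero on the pair `(v, iv)`. -/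
theorem chern_gauge {s e : Cn N}
    (hs : ∀ τ, leviForm (hessBilin (sumGauge n) (B z) v) s (realBasis (Sum.inl τ)) =
      mixedLeviForm (sumGauge n) (B z) (fderiv ℝ B z) e v (realBasis (Sum.inl τ)))
    (d : Cn N) :
    leviForm (hessBilin Φ (B z) v) s d = mixedLeviForm Φ (B z) (fderiv ℝ B z) e v d := by
  have key : ∀ d, hessForm Φ (B z) v s d + hessForm Φ (B z) v (Complex.I • s) (Complex.I • d) =
      mixedForm Φ (B z) (fderiv ℝ B z e) v d +
        mixedForm Φ (B z) (fderiv ℝ B z (Complex.I • e)) v (Complex.I • d) := by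
    intro d
    have h1 := hB.chern_component hz hs d
    have h2 : fderiv ℝ B z e v v = (2 : ℝ) • B z v s := by
      rw [hB.symm z hz v, hB.chern_component hz hs v, hB.fderiv_apply_I_self hz, add_zero]
    have h3 : fderiv ℝ B z (Complex.I • e) v v = (2 : ℝ) • B z v (Complex.I • s) := by
      have h := hB.chern_component hz hs (Complex.I • v)
      rw [hB.fderiv_apply_I_self hz, I_smul_I_smul, map_neg, zero_add] at h
      rw [hB.apply_I_right hz, smul_neg, hB.symm z hz, h, neg_neg]
    have h4 : fderiv ℝ Φ (B z v v) ((2 : ℝ) • B z s d) =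
        fderiv ℝ Φ (B z v v) (fderiv ℝ B z e v d) +
          fderiv ℝ Φ (B z v v) (fderiv ℝ B z (Complex.I • e) v (Complex.I • d)) := by
      rw [h1, map_add]
    have h5 : ∀ x, fderiv ℝ Φ (B z v v) ((2 : ℝ) • x) = 2 * fderiv ℝ Φ (B z v v) x :=
      fun x => by rw [map_smul, smul_eq_mul]
    have h6 : ∀ x y, fderiv ℝ (fderiv ℝ Φ) (B z v v) ((2 : ℝ) • x) y =
        2 * fderiv ℝ (fderiv ℝ Φ) (B z v v) x y :=
      fun x y => by rw [map_smul, smul_apply, smul_eq_mul]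
    rw [h5] at h4
    simp only [hessForm, mixedForm, hB.map_I z hz, h2, h3, h5, h6]
    linarith
  -- `key` is the real part of the claim; replacing `d` by `id` gives the imaginary part.
  have key' := key (Complex.I • d)
  rw [I_smul_I_smul] at key'
  have e1 : hessForm Φ (B z) v (Complex.I • s) (-d) = -hessForm Φ (B z) v (Complex.I • s) d := by
    simpa using map_neg (hessBilin Φ (B z) v (Complex.I • s)) d
  have e2 : mixedForm Φ (B z) (fderiv ℝ B z (Complex.I • e)) v (-d) =
      -mixedForm Φ (B z) (fderiv ℝ B z (Complex.I • e)) v d := by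
    simp only [mixedForm, map_neg, smul_neg]
    ring
  rw [e1, e2, ← sub_eq_add_neg, ← sub_eq_add_neg] at key'
  simp only [leviForm, mixedLeviForm, hessBilin_apply, key d, key']

include hΦ hv

theorem exists_hessForm_eq (φ : Cn N →ₗ[ℝ] ℝ) : ∃ s, ∀ d, hessForm Φ (B z) v s d = φ d := by
  have hinj : Function.Injective (hessBilin Φ (B z) v) := by
    rw [injective_iff_map_eq_zero]
    intro c hc
    by_contra h
    exact (hB.hessForm_pos hΦ hz hv h).ne' (DFunLike.congr_fun hc c)
  have hsurj := (LinearMap.injective_iff_surjective_of_finrank_eq_finrank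
    (Subspace.dual_finrank_eq (K := ℝ) (V := Cn N)).symm).1 hinj
  obtain ⟨s, hs⟩ := hsurj φ
  exact ⟨s, fun d => DFunLike.congr_fun hs d⟩

theorem sprayCoeff_eq_of {s : Cn N}
    (hs : ∀ d, hessForm Φ (B z) v s d = sprayForm Φ (B z) (fderiv ℝ B z) v d)
    (b : Fin N ⊕ Fin N) :
    sprayCoeff (fun z w => Φ (B z w w)) b z v = 1 / 2 * (realBasisBasis N).repr s b := by
  set H := realHessian (fun z w => Φ (B z w w)) z v with hH
  have h1 : H.mulVec ((realBasisBasis N).repr s) = fun c =>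
      fderiv ℝ (fun z' => dReal c (fun w => Φ (B z' w w)) v) z v -
        dReal c (fun z' => Φ (B z' v v)) z := by
    funext c
    refine Eq.trans ?_ (hB.sprayForm_eq hz (hB.contDiffAt_two_gauge hΦ hz hv) (realBasis c)).symm
    rw [← hs, ← hessBilin_apply, hB.hessBilin_symm hΦ hz hv]
    conv_rhs => rw [← sum_smul_realBasis_repr s, map_sum]
    rw [hH, hB.realHessian_eq hΦ hz hv]
    simp only [Matrix.mulVec, dotProduct, LinearMap.BilinForm.toMatrix_apply,
      realBasisBasis_apply, map_smul, smul_eq_mul, mul_comm]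
  have hu : IsUnit H.det := (Matrix.isUnit_iff_isUnit_det _).1 (hB.posDef_realHessian hΦ hz hv).isUnit
  have h2 : (realBasisBasis N).repr s b = (H⁻¹.mulVec (H.mulVec ((realBasisBasis N).repr s))) b := by
    rw [Matrix.mulVec_mulVec, Matrix.nonsing_inv_mul _ hu, Matrix.one_mulVec]
  rw [h2, h1]
  rfl

theorem sprayVector_eq_of {s : Cn N}
    (hs : ∀ d, hessForm Φ (B z) v s d = sprayForm Φ (B z) (fderiv ℝ B z) v d) :
    sprayVector (fun z w => Φ (B z w w)) z v = s := by
  simp only [sprayVector, hB.sprayCoeff_eq_of hΦ hz hv hs]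
  simpa using sum_smul_realBasis_repr s

omit hΦ in
theorem exists_spray : ∃ s, ∀ d, hessForm (sumGauge n) (B z) v s d =
    sprayForm (sumGauge n) (B z) (fderiv ℝ B z) v d := by
  let φ : Cn N →L[ℝ] ℝ := (sumGauge n).comp
    ((2 : ℝ) • fderiv ℝ B z v v - ((fderiv ℝ B z).flip v).flip v)
  obtain ⟨s, hs⟩ := hB.exists_hessForm_eq isGauge_sumGauge hz hv φ
  refine ⟨s, fun d => (hs d).trans ?_⟩
  simp [φ, sprayForm, Finset.mul_sum]

theorem sprayCoeff_gauge (b : Fin N ⊕ Fin N) :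
    sprayCoeff (fun z w => Φ (B z w w)) b z v =
      sprayCoeff (fun z w => sumGauge n (B z w w)) b z v := by
  obtain ⟨s, hs⟩ := hB.exists_spray hz hv
  rw [hB.sprayCoeff_eq_of isGauge_sumGauge hz hv hs,
    hB.sprayCoeff_eq_of hΦ hz hv (hB.spray_gauge hz hs)]

theorem sprayVector_gauge : sprayVector (fun z w => Φ (B z w w)) z v =
    sprayVector (fun z w => sumGauge n (B z w w)) z v := by
  simp only [sprayVector, hB.sprayCoeff_gauge hΦ hz hv]

theorem chernFinslerNonlinear_eq_of {s : Cn N} {μ : Fin N}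
    (hs : ∀ τ, leviForm (hessBilin Φ (B z) v) s (realBasis (Sum.inl τ)) =
      mixedLeviForm Φ (B z) (fderiv ℝ B z) (realBasis (Sum.inl μ)) v (realBasis (Sum.inl τ)))
    (α : Fin N) :
    chernFinslerNonlinear (fun z w => Φ (B z w w)) α μ z v = s α := by
  set L := leviMatrix (fun z w => Φ (B z w w)) z v with hL
  have hu : IsUnit L.det := (Matrix.isUnit_iff_isUnit_det _).1 (hB.posDef_leviMatrix hΦ hz hv).isUnit
  have h1 : Matrix.vecMul s L = fun τ =>
      dHol μ (fun z' => dAnti τ (fun w => (Φ (B z' w w) : ℂ)) v) z := by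
    funext τ
    rw [hB.mixedLeviForm_eq hz (hB.contDiffAt_two_gauge hΦ hz hv), ← hs, ← leviForm_sum_left,
      hL, hB.leviMatrix_eq hΦ hz hv]
    rfl
  have h2 : s α = Matrix.vecMul (Matrix.vecMul s L) L⁻¹ α := by
    rw [Matrix.vecMul_vecMul, Matrix.mul_nonsing_inv _ hu, Matrix.vecMul_one]
  rw [h2, h1]
  simp only [chernFinslerNonlinear, Matrix.vecMul, dotProduct, mul_comm, ← hL]

/-- The connection coefficients solve their linear system. For `sumGauge` this supplies the solution
that `chern_gauge` carries over to other gauges. -/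
theorem leviForm_chernFinslerNonlinear (μ τ : Fin N) :
    leviForm (hessBilin Φ (B z) v)
        (fun α => chernFinslerNonlinear (fun z w => Φ (B z w w)) α μ z v)
        (realBasis (Sum.inl τ)) =
      mixedLeviForm Φ (B z) (fderiv ℝ B z) (realBasis (Sum.inl μ)) v
        (realBasis (Sum.inl τ)) := by
  set L := leviMatrix (fun z w => Φ (B z w w)) z v with hL
  have hu : IsUnit L.det := (Matrix.isUnit_iff_isUnit_det _).1 (hB.posDef_leviMatrix hΦ hz hv).isUnit
  set r : Fin N → ℂ := fun τ =>
      dHol μ (fun z' => dAnti τ (fun w => (Φ (B z' w w) : ℂ)) v) z with hr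
  have h1 : (fun α => chernFinslerNonlinear (fun z w => Φ (B z w w)) α μ z v) =
      Matrix.vecMul r L⁻¹ := by
    funext α
    simp only [chernFinslerNonlinear, Matrix.vecMul, dotProduct, mul_comm, ← hL, hr]
  have h2 : Matrix.vecMul (Matrix.vecMul r L⁻¹) L τ = r τ := by
    rw [Matrix.vecMul_vecMul, Matrix.nonsing_inv_mul _ hu, Matrix.vecMul_one]
  rw [← hB.mixedLeviForm_eq hz (hB.contDiffAt_two_gauge hΦ hz hv), h1, ← leviForm_sum_left]
  rw [hL, hB.leviMatrix_eq hΦ hz hv, ← hB.leviMatrix_eq hΦ hz hv, ← hL] at h2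
  refine Eq.trans ?_ h2
  conv_rhs => rw [Matrix.vecMul]
  simp only [dotProduct, hL, hB.leviMatrix_eq hΦ hz hv, Matrix.of_apply]

theorem chernFinslerNonlinear_gauge (α μ : Fin N) :
    chernFinslerNonlinear (fun z w => Φ (B z w w)) α μ z v =
      chernFinslerNonlinear (fun z w => sumGauge n (B z w w)) α μ z v :=
  hB.chernFinslerNonlinear_eq_of hΦ hz hv (fun _ => hB.chern_gauge hz
    (hB.leviForm_chernFinslerNonlinear isGauge_sumGauge hz hv μ) _) α

/-- The coefficients are fibre derivatives, so agreement near `v` is required; it holds on the open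
set of nonzero vectors. -/
theorem chernFinsler_gauge (α ν μ : Fin N) :
    chernFinsler (fun z w => Φ (B z w w)) α ν μ z v =
      chernFinsler (fun z w => sumGauge n (B z w w)) α ν μ z v := by
  have h : (fun w => chernFinslerNonlinear (fun z w => Φ (B z w w)) α μ z w) =ᶠ[𝓝 v]
      fun w => chernFinslerNonlinear (fun z w => sumGauge n (B z w w)) α μ z w := by
    filter_upwards [isOpen_ne.mem_nhds hv] with w hw
    exact hB.chernFinslerNonlinear_gauge hΦ hz hw α μ
  rw [chernFinsler, dHol, h.fderiv_eq]
  rfl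

theorem realBerwaldCoeff_gauge (b a c : Fin N ⊕ Fin N) :
    realBerwaldCoeff (fun z w => Φ (B z w w)) b a c z v =
      realBerwaldCoeff (fun z w => sumGauge n (B z w w)) b a c z v := by
  have h : (fun w => sprayCoeff (fun z w => Φ (B z w w)) b z w) =ᶠ[𝓝 v]
      fun w => sprayCoeff (fun z w => sumGauge n (B z w w)) b z w := by
    filter_upwards [isOpen_ne.mem_nhds hv] with w hw
    exact hB.sprayCoeff_gauge hΦ hz hw b
  have h' : (fun w => fderiv ℝ (fun w => sprayCoeff (fun z w => Φ (B z w w)) b z w) w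
      (realBasis c)) =ᶠ[𝓝 v]
      fun w => fderiv ℝ (fun w => sprayCoeff (fun z w => sumGauge n (B z w w)) b z w) w
        (realBasis c) := by
    filter_upwards [h.fderiv (𝕜 := ℝ)] with w hw
    rw [hw]
  have h2 := h'.fderiv_eq (𝕜 := ℝ)
  exact DFunLike.congr_fun h2 (realBasis a)

end IsSplitForm

end Connection

/-! ### Derivatives of determinants. -/

section Determinant

variable {ι : Type*} [Fintype ι] [DecidableEq ι]

theorem differentiable_det : Differentiable ℝ fun A : ι → ι → ℝ => (Matrix.of A).det := by
  simp only [Matrix.det_apply, Matrix.of_apply]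
  fun_prop

theorem DifferentiableAt.matrix_det {E : Type*} [NormedAddCommGroup E] [NormedSpace ℝ E]
    {A : E → Matrix ι ι ℝ} {x : E} (hA : ∀ a b, DifferentiableAt ℝ (fun y => A y a b) x) :
    DifferentiableAt ℝ (fun y => (A y).det) x := by
  have h : DifferentiableAt ℝ (fun y a b => A y a b) x :=
    differentiableAt_pi.2 fun a => differentiableAt_pi.2 fun b => hA a b
  exact DifferentiableAt.comp (f := fun y a b => A y a b) (g := fun A => (Matrix.of A).det) x
    (differentiable_det _) h

theorem HasDerivAt.matrix_det_zero {A : ℝ → Matrix ι ι ℝ} {x : ℝ}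
    (hA : ∀ a b, HasDerivAt (fun y => A y a b) 0 x) : HasDerivAt (fun y => (A y).det) 0 x := by
  have h : HasDerivAt (fun y a b => A y a b) (0 : ι → ι → ℝ) x :=
    hasDerivAt_pi.2 fun a => hasDerivAt_pi.2 fun b => hA a b
  have h' := HasFDerivAt.comp_hasDerivAt (f := fun y a b => A y a b) x
    (differentiable_det (fun a b => A x a b)).hasFDerivAt h
  rw [map_zero] at h'
  exact h'

end Determinant

/-! ### The sum gauge: Chern and Levi-Civita connections of the product metric. -/

section Hermitian

variable {n N : ℕ}

theorem dHol_complexLinear (ℓ : Cn N →ₗ[ℂ] ℂ) (ν : Fin N) (v : Cn N) :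
    dHol ν ℓ v = ℓ (realBasis (Sum.inl ν)) := by
  have h : HasFDerivAt ℓ ((ℓ.toContinuousLinearMap).restrictScalars ℝ) v :=
    ((ℓ.toContinuousLinearMap).restrictScalars ℝ).hasFDerivAt
  rw [dHol, h.fderiv, ← I_smul_realBasis_inl]
  simp only [ContinuousLinearMap.coe_restrictScalars', LinearMap.coe_toContinuousLinearMap',
    map_smul, smul_eq_mul]
  linear_combination (-1 / 2 : ℂ) * ℓ (realBasis (Sum.inl ν)) * Complex.I_sq

/-- The matrix `Q_{α β̄}` of the sum of the forms. -/
def hermMatrix (B : Cn N →L[ℝ] Cn N →L[ℝ] (Fin n → ℝ)) : Matrix (Fin N) (Fin N) ℂ :=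
  Matrix.of fun α β => leviForm (hessBilin (sumGauge n) B 0)
      (realBasis (Sum.inl α)) (realBasis (Sum.inl β))

theorem hessBilin_sumGauge (B : Cn N →L[ℝ] Cn N →L[ℝ] (Fin n → ℝ)) (v : Cn N) :
    hessBilin (sumGauge n) B v = hessBilin (sumGauge n) B 0 := by
  ext c d
  simp

namespace IsSplitForm

variable {U : Set (Cn N)} {B : Cn N → Cn N →L[ℝ] Cn N →L[ℝ] (Fin n → ℝ)} (hB : IsSplitForm U B)
  {Φ : (Fin n → ℝ) → ℝ} {z v : Cn N} (hz : z ∈ U)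

include hB hz

/-- Complex linearity comes from the invariance of the derivative of `B` under `i`. It makes
`∂/∂v^ν` of this expression its value at a basis vector. -/
theorem exists_mixedLeviForm_linear (e d : Cn N) : ∃ ℓ : Cn N →ₗ[ℂ] ℂ, ∀ w,
    ℓ w = mixedLeviForm (sumGauge n) (B z) (fderiv ℝ B z) e w d := by
  let f : Cn N →ₗ[ℝ] ℂ :=
    { toFun := fun w => mixedLeviForm (sumGauge n) (B z) (fderiv ℝ B z) e w d
      map_add' := fun w w' => by
        simp only [mixedLeviForm, mixedForm_sumGauge, map_add, add_apply, Pi.add_apply,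
          Finset.sum_add_distrib]
        push_cast
        ring
      map_smul' := fun r w => by
        simp only [mixedLeviForm, mixedForm_sumGauge, (fderiv ℝ B z _).map_smul, smul_apply,
          Pi.smul_apply, smul_eq_mul, ← Finset.mul_sum, Complex.real_smul, RingHom.id_apply]
        push_cast
        ring }
  have hI : ∀ w, f (Complex.I • w) = Complex.I * f w := by
    intro w
    have h1 : ∀ e, fderiv ℝ B z e (Complex.I • w) d = -fderiv ℝ B z e w (Complex.I • d) :=
      fun e => by rw [hB.fderiv_apply_I_right hz, neg_neg]
    simp only [f, LinearMap.coe_mk, AddHom.coe_mk, mixedLeviForm, mixedForm_sumGauge,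
      hB.fderiv_map_I hz, h1, Pi.neg_apply, Finset.sum_neg_distrib]
    push_cast
    linear_combination (-1 / 4 : ℂ) *
      (2 * (∑ l, (fderiv ℝ B z e w (Complex.I • d) l : ℂ)) -
        2 * ∑ l, (fderiv ℝ B z (Complex.I • e) w d l : ℂ)) * Complex.I_sq
  refine ⟨{ toFun := f, map_add' := map_add f, map_smul' := fun x w => ?_ }, fun w => rfl⟩
  rw [smul_eq_re_add_im, map_add, f.map_smul, f.map_smul, hI, RingHom.id_apply, smul_eq_mul]
  conv_rhs => rw [← Complex.re_add_im x]
  simp only [Complex.real_smul]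
  ring

/-- These are the Chern connection coefficients of `Q`. The right-hand side does not contain `v`,
since the Levi matrix of a quadratic function is constant on the fibre; this is the complex Berwald
property. -/
theorem chernFinsler_sumGauge (hv : v ≠ 0) (α ν μ : Fin N) :
    chernFinsler (fun z w => sumGauge n (B z w w)) α ν μ z v =
      ∑ τ, (hermMatrix (B z))⁻¹ τ α * mixedLeviForm (sumGauge n) (B z) (fderiv ℝ B z)
        (realBasis (Sum.inl μ)) (realBasis (Sum.inl ν)) (realBasis (Sum.inl τ)) := by
  choose ℓ hℓ using fun τ : Fin N => hB.exists_mixedLeviForm_linear hz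
    (realBasis (Sum.inl μ)) (realBasis (Sum.inl τ))
  have h : (fun w => chernFinslerNonlinear (fun z w => sumGauge n (B z w w)) α μ z w) =ᶠ[𝓝 v]
      (∑ τ, (hermMatrix (B z))⁻¹ τ α • ℓ τ : Cn N →ₗ[ℂ] ℂ) := by
    filter_upwards [isOpen_ne.mem_nhds hv] with w hw
    rw [chernFinslerNonlinear, LinearMap.sum_apply]
    refine Finset.sum_congr rfl fun τ _ => ?_
    rw [hB.mixedLeviForm_eq hz (hB.contDiffAt_two_gauge isGauge_sumGauge hz hw),
      hB.leviMatrix_eq isGauge_sumGauge hz hw, hessBilin_sumGauge, LinearMap.smul_apply, hℓ,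
      hermMatrix, smul_eq_mul]
  rw [chernFinsler, dHol, h.fderiv_eq, ← dHol, dHol_complexLinear, LinearMap.sum_apply]
  simp only [LinearMap.smul_apply, hℓ, smul_eq_mul]

theorem injective_hessBilin_sumGauge :
    Function.Injective (hessBilin (sumGauge n) (B z) 0) := by
  rw [injective_iff_map_eq_zero]
  intro c hc
  by_contra h
  exact (hB.hessForm_pos isGauge_sumGauge hz h h).ne' (by simpa using DFunLike.congr_fun hc c)

/-- The Levi-Civita connection of `Q`, defined by the Koszul formula. Its compatibility with each
component of `B` separately, not merely with their sum, is what the S-curvature requires. -/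
theorem exists_connection : ∃ Γ : Cn N →L[ℝ] Cn N →L[ℝ] Cn N,
    (∀ w d, hessForm (sumGauge n) (B z) w (Γ w w) d =
      sprayForm (sumGauge n) (B z) (fderiv ℝ B z) w d) ∧
    ∀ x y w, fderiv ℝ B z x y w = B z (Γ x y) w + B z y (Γ x w) := by
  let A : Cn N ≃ₗ[ℝ] Module.Dual ℝ (Cn N) := LinearEquiv.ofBijective
    (hessBilin (sumGauge n) (B z) 0) ⟨hB.injective_hessBilin_sumGauge hz,
      (LinearMap.injective_iff_surjective_of_finrank_eq_finrank
        (Subspace.dual_finrank_eq (K := ℝ) (V := Cn N)).symm).1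
        (hB.injective_hessBilin_sumGauge hz)⟩
  let φ : Cn N → Cn N → Module.Dual ℝ (Cn N) := fun x y =>
    (sumGauge n).comp (fderiv ℝ B z x y + fderiv ℝ B z y x - ((fderiv ℝ B z).flip x).flip y)
  have hφ : ∀ x y d, φ x y d = sumGauge n (fderiv ℝ B z x y d) + sumGauge n (fderiv ℝ B z y x d) -
      sumGauge n (fderiv ℝ B z d x y) := fun x y d => by
    change sumGauge n (fderiv ℝ B z x y d + fderiv ℝ B z y x d - fderiv ℝ B z d x y) = _
    rw [map_sub, map_add]
  let Γ : Cn N →ₗ[ℝ] Cn N →ₗ[ℝ] Cn N := LinearMap.mk₂ ℝ (fun x y => A.symm (φ x y))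
    (fun x x' y => by
      rw [← map_add]
      congr 1
      refine LinearMap.ext fun d => ?_
      simp only [hφ, map_add, add_apply, LinearMap.add_apply]
      ring)
    (fun r x y => by
      rw [← map_smul]
      congr 1
      refine LinearMap.ext fun d => ?_
      simp only [hφ, map_smul, smul_apply, LinearMap.smul_apply, smul_eq_mul]
      ring)
    (fun x y y' => by
      rw [← map_add]
      congr 1
      refine LinearMap.ext fun d => ?_
      simp only [hφ, map_add, add_apply, LinearMap.add_apply]
      ring)
    (fun r x y => by
      rw [← map_smul]
      congr 1
      refine LinearMap.ext fun d => ?_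
      simp only [hφ, map_smul, smul_apply, LinearMap.smul_apply, smul_eq_mul]
      ring)
  have hΓ : ∀ x y, Γ x y = A.symm (φ x y) := fun x y => rfl
  have hspray : ∀ w d, hessForm (sumGauge n) (B z) w (Γ w w) d =
      sprayForm (sumGauge n) (B z) (fderiv ℝ B z) w d := fun w d => by
    have h : A (Γ w w) d = φ w w d := by rw [hΓ, LinearEquiv.apply_symm_apply]
    have h' : A (Γ w w) d = hessForm (sumGauge n) (B z) w (Γ w w) d := by
      change hessForm (sumGauge n) (B z) 0 (Γ w w) d = _
      rw [hessForm_sumGauge, hessForm_sumGauge]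
    rw [← h', h, hφ, sprayForm, mixedForm_sumGauge, ContinuousLinearMap.fderiv, sumGauge_apply]
    ring
  have hsymm : ∀ x y, Γ x y = Γ y x := fun x y => by
    rw [hΓ, hΓ]
    congr 1
    refine LinearMap.ext fun d => ?_
    rw [hφ, hφ, hB.fderiv_symm hz d x y]
    ring
  -- Polarizing `spray_component` at `x`, `y` and `x + y` yields the Koszul formula in every
  -- component, although `Γ` was defined by the sum alone.
  have hpol : ∀ x y d l, 2 * B z (Γ x y) d l =
      fderiv ℝ B z x y d l + fderiv ℝ B z y x d l - fderiv ℝ B z d x y l := fun x y d l => by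
    have key := fun w => congrFun (hB.spray_component hz (hspray w) d) l
    have h1 := key x
    have h2 := key y
    have h3 := key (x + y)
    simp only [map_add, add_apply, LinearMap.add_apply, Pi.sub_apply, Pi.add_apply,
      Pi.smul_apply, smul_eq_mul, hsymm y x, hB.fderiv_symm hz d y x] at h1 h2 h3
    linarith
  refine ⟨Γ.toContinuousBilinearMap, hspray, fun x y w => ?_⟩
  ext l
  have h1 := hpol x y w l
  have h2 := hpol x w y l
  rw [hB.symm z hz] at h2
  rw [hB.fderiv_symm hz x w y] at h2
  simp only [LinearMap.toContinuousBilinearMap_apply, Pi.add_apply]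
  linarith [congrFun (hB.fderiv_symm hz y x w) l, congrFun (hB.fderiv_symm hz w x y) l]

/-- Away from zero the spray is the quadratic map `w ↦ Γ w w`, so its second derivatives are
constant. -/
theorem realBerwaldCoeff_sumGauge (hv : v ≠ 0) {Γ : Cn N →L[ℝ] Cn N →L[ℝ] Cn N}
    (hΓ : ∀ w d, hessForm (sumGauge n) (B z) w (Γ w w) d =
      sprayForm (sumGauge n) (B z) (fderiv ℝ B z) w d) (b a c : Fin N ⊕ Fin N) :
    realBerwaldCoeff (fun z w => sumGauge n (B z w w)) b a c z v =
      1 / 2 * ((realBasisBasis N).repr (Γ (realBasis a) (realBasis c)) b +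
        (realBasisBasis N).repr (Γ (realBasis c) (realBasis a)) b) := by
  let p : Cn N →L[ℝ] ℝ := LinearMap.toContinuousLinearMap ((realBasisBasis N).coord b)
  let f : Cn N → ℝ := fun w => 1 / 2 * p (Γ w w)
  have hf : ∀ w d, fderiv ℝ f w d = 1 / 2 * p (Γ d w + Γ w d) := fun w d => by
    have h := (p.hasFDerivAt.comp w
      ((Γ.hasFDerivAt (x := w)).clm_apply (hasFDerivAt_id w))).const_mul (1 / 2 : ℝ)
    change fderiv ℝ (fun w => 1 / 2 * p (Γ w w)) w d = _
    refine (DFunLike.congr_fun h.fderiv d).trans ?_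
    simp
    ring
  have hf2 : ∀ w, fderiv ℝ (fun w => fderiv ℝ f w (realBasis c)) w (realBasis a) =
      1 / 2 * (p (Γ (realBasis a) (realBasis c)) + p (Γ (realBasis c) (realBasis a))) := fun w => by
    simp only [hf]
    have h := (p.hasFDerivAt.comp w (((Γ (realBasis c)).hasFDerivAt (x := w)).add
      ((Γ.flip (realBasis c)).hasFDerivAt (x := w)))).const_mul (1 / 2 : ℝ)
    refine (DFunLike.congr_fun h.fderiv (realBasis a)).trans ?_
    simp
    ring
  have h : (fun w => sprayCoeff (fun z w => sumGauge n (B z w w)) b z w) =ᶠ[𝓝 v] f := by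
    filter_upwards [isOpen_ne.mem_nhds hv] with w hw
    rw [hB.sprayCoeff_eq_of isGauge_sumGauge hz hw (hΓ w)]
    rfl
  have h' : (fun w => fderiv ℝ (fun w => sprayCoeff (fun z w => sumGauge n (B z w w)) b z w) w
      (realBasis c)) =ᶠ[𝓝 v] fun w => fderiv ℝ f w (realBasis c) := by
    filter_upwards [h.fderiv (𝕜 := ℝ)] with w hw
    rw [hw]
  have h2 := h'.fderiv_eq (𝕜 := ℝ)
  exact (DFunLike.congr_fun h2 (realBasis a)).trans (hf2 v)

theorem realBerwaldCoeff_eq (hΦ : IsGauge Φ) {v w : Cn N} (hv : v ≠ 0) (hw : w ≠ 0)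
    (b a c : Fin N ⊕ Fin N) :
    realBerwaldCoeff (fun z w => Φ (B z w w)) b a c z v =
      realBerwaldCoeff (fun z w => Φ (B z w w)) b a c z w := by
  obtain ⟨Γ, hΓ, -⟩ := hB.exists_connection hz
  rw [hB.realBerwaldCoeff_gauge hΦ hz hv, hB.realBerwaldCoeff_gauge hΦ hz hw,
    hB.realBerwaldCoeff_sumGauge hz hv hΓ, hB.realBerwaldCoeff_sumGauge hz hw hΓ]

theorem chernFinsler_eq (hΦ : IsGauge Φ) {v w : Cn N} (hv : v ≠ 0) (hw : w ≠ 0)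
    (α ν μ : Fin N) :
    chernFinsler (fun z w => Φ (B z w w)) α ν μ z v =
      chernFinsler (fun z w => Φ (B z w w)) α ν μ z w := by
  rw [hB.chernFinsler_gauge hΦ hz hv, hB.chernFinsler_gauge hΦ hz hw,
    hB.chernFinsler_sumGauge hz hv, hB.chernFinsler_sumGauge hz hw]

theorem contDiffAt_comp_quad (hΦ : IsGauge Φ) (hv : v ≠ 0) :
    ContDiffAt ℝ ∞ (fun x : Cn N × Cn N => Φ (B x.1 x.2 x.2)) (z, v) := by
  have h1 : ContDiffAt ℝ ∞ (fun x : Cn N × Cn N => B x.1) (z, v) :=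
    ContDiffAt.comp (g := B) (z, v) (hB.contDiffAt hz) contDiffAt_fst
  exact ContDiffAt.comp (f := fun x : Cn N × Cn N => B x.1 x.2 x.2) (z, v)
    (hB.contDiffAt_gauge hΦ hz hv) ((h1.clm_apply contDiffAt_snd).clm_apply contDiffAt_snd)

/-- Identifies `∂Q_{α β̄}/∂z^μ` with the right-hand side of the Chern equation, so that the Kähler
condition becomes symmetry of the connection coefficients. -/
theorem dHol_hermitian {h : Cn N → ℂ} {v w : Cn N}
    (hh : ∀ x, h x = antilin (fun d => sumGauge n (B x v d)) w) (μ : Fin N) :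
    dHol μ h z = mixedLeviForm (sumGauge n) (B z) (fderiv ℝ B z) (realBasis (Sum.inl μ)) v w := by
  have hd := hB.differentiableAt hz
  have h1 : HasFDerivAt (fun x => 2 * sumGauge n (B x v w)) _ z :=
    (((sumGauge n).hasFDerivAt).comp z (hasFDerivAt_apply₂ hd v w)).const_mul (2 : ℝ)
  have h2 : HasFDerivAt (fun x => 2 * sumGauge n (B x v (Complex.I • w))) _ z :=
    (((sumGauge n).hasFDerivAt).comp z (hasFDerivAt_apply₂ hd v (Complex.I • w))).const_mul (2 : ℝ)
  have h3 := dHol_antilin (φ := fun x d => 2 * sumGauge n (B x v d)) μ h1 h2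
  have h4 : h = fun x => antilin (fun d => 2 * sumGauge n (B x v d)) w / 2 := by
    funext x
    rw [hh]
    simp only [antilin]
    push_cast
    ring
  rw [h4, h3]
  simp only [mixedLeviForm, mixedForm_sumGauge]
  simp

end IsSplitForm

end Hermitian

/-! ### Distortion and S-curvature. -/

section Distortion

variable {n N : ℕ}

/-- The determinant of the real Hessian of the sum of the forms. -/
def metricDet (B : Cn N →L[ℝ] Cn N →L[ℝ] (Fin n → ℝ)) : ℝ :=
  (LinearMap.BilinForm.toMatrix (realBasisBasis N) (hessBilin (sumGauge n) B 0)).det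

theorem det_toMatrix_comp (A : LinearMap.BilinForm ℝ (Cn N)) (T : Cn N →ₗ[ℝ] Cn N) :
    (LinearMap.BilinForm.toMatrix (realBasisBasis N) (A.comp T T)).det =
      (LinearMap.BilinForm.toMatrix (realBasisBasis N) A).det * LinearMap.det T ^ 2 := by
  rw [LinearMap.BilinForm.toMatrix_comp (realBasisBasis N) (realBasisBasis N), Matrix.det_mul,
    Matrix.det_mul, Matrix.det_transpose, LinearMap.det_toMatrix]
  ring

theorem hasDerivAt_apply₂_zero {E F W : Type*} [NormedAddCommGroup E] [NormedSpace ℝ E]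
    [NormedAddCommGroup F] [NormedSpace ℝ F] [NormedAddCommGroup W] [NormedSpace ℝ W]
    {A : ℝ → E →L[ℝ] F →L[ℝ] W} {x : ℝ → E} {y : ℝ → F} {s : ℝ} (hA : HasDerivAt A 0 s)
    (hx : HasDerivAt x 0 s) (hy : HasDerivAt y 0 s) : HasDerivAt (fun r => A r (x r) (y r)) 0 s := by
  simpa using (hA.clm_apply hx).clm_apply hy

/-- The Hessian depends on its arguments only through these four values of `B`, so it is stationary
whenever they are. -/
theorem hasDerivAt_hessForm_zero {Φ : (Fin n → ℝ) → ℝ}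
    {B : ℝ → Cn N →L[ℝ] Cn N →L[ℝ] (Fin n → ℝ)} {v c d : ℝ → Cn N} {s : ℝ}
    (hΦ : ContDiffAt ℝ ∞ Φ (B s (v s) (v s)))
    (hvv : HasDerivAt (fun r => B r (v r) (v r)) 0 s)
    (hcd : HasDerivAt (fun r => B r (c r) (d r)) 0 s)
    (hvc : HasDerivAt (fun r => B r (v r) (c r)) 0 s)
    (hvd : HasDerivAt (fun r => B r (v r) (d r)) 0 s) :
    HasDerivAt (fun r => hessForm Φ (B r) (v r) (c r) (d r)) 0 s := by
  have h1 : ContDiffAt ℝ 2 (fderiv ℝ Φ) (B s (v s) (v s)) :=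
    hΦ.fderiv_right (m := 2) (by norm_cast)
  have h2 : ContDiffAt ℝ 1 (fderiv ℝ (fderiv ℝ Φ)) (B s (v s) (v s)) :=
    h1.fderiv_right (m := 1) (by norm_num)
  have k1 : HasDerivAt (fun r => fderiv ℝ Φ (B r (v r) (v r))) 0 s := by
    have h := HasFDerivAt.comp_hasDerivAt (f := fun r => B r (v r) (v r)) s
      (h1.differentiableAt (by norm_num)).hasFDerivAt hvv
    rw [map_zero] at h
    exact h
  have k2 : HasDerivAt (fun r => fderiv ℝ (fderiv ℝ Φ) (B r (v r) (v r))) 0 s := by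
    have h := HasFDerivAt.comp_hasDerivAt (f := fun r => B r (v r) (v r)) s
      (h2.differentiableAt (by norm_num)).hasFDerivAt hvv
    rw [map_zero] at h
    exact h
  have k3 : HasDerivAt (fun r => (2 : ℝ) • B r (c r) (d r)) 0 s := by
    have h := hcd.const_smul (2 : ℝ)
    rw [smul_zero] at h
    exact h
  have k4 : HasDerivAt (fun r => fderiv ℝ Φ (B r (v r) (v r)) ((2 : ℝ) • B r (c r) (d r))) 0 s := by
    simpa using k1.clm_apply k3
  have h := k4.add ((hasDerivAt_apply₂_zero k2 hvc hvd).const_mul 4)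
  rw [mul_zero, add_zero] at h
  exact h

namespace IsSplitForm

variable {U : Set (Cn N)} {B : Cn N → Cn N →L[ℝ] Cn N →L[ℝ] (Fin n → ℝ)} (hB : IsSplitForm U B)
  {Φ : (Fin n → ℝ) → ℝ} (hΦ : IsGauge Φ) {z v : Cn N} (hz : z ∈ U) (hv : v ≠ 0)

include hB hz

theorem metricDet_pos : 0 < metricDet (B z) := by
  refine (posDef_toMatrix (fun c d => ?_) fun c hc => ?_).det_pos
  · simp [hB.symm z hz c d]
  · have := hB.hessForm_pos isGauge_sumGauge hz hc hc
    simpa using this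

/-- A linear map that matches all components of `B` at the two points matches the unit balls of `Φ`
as well as the summed metrics. Its determinant scales the two factors inversely. -/
theorem volume_mul_sqrt_metricDet {z' : Cn N} (hz' : z' ∈ U) :
    (MeasureTheory.volume {w : Cn N | Φ (B z w w) < 1}).toReal * √(metricDet (B z)) =
      (MeasureTheory.volume {w : Cn N | Φ (B z' w w) < 1}).toReal * √(metricDet (B z')) := by
  obtain ⟨T, hT⟩ := hB.isometric z hz z' hz'
  have hpol : ∀ x y, B z' (T x) (T y) = B z x y := fun x y => by
    ext l
    have h1 := congrFun (hT x) l
    have h2 := congrFun (hT y) l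
    have h3 := congrFun (hT (x + y)) l
    simp only [map_add, add_apply, Pi.add_apply, hB.symm z hz y x,
      hB.symm z' hz' (T y) (T x)] at h3
    linarith
  have hdet : LinearMap.det (T : Cn N →ₗ[ℝ] Cn N) ≠ 0 := T.isUnit_det'.ne_zero
  have h1 : {w : Cn N | Φ (B z w w) < 1} =
      (T : Cn N →ₗ[ℝ] Cn N) ⁻¹' {w : Cn N | Φ (B z' w w) < 1} := by
    ext w
    simp [hT]
  have h2 : hessBilin (sumGauge n) (B z) 0 = LinearMap.BilinForm.comp
      (hessBilin (sumGauge n) (B z') 0) (T : Cn N →ₗ[ℝ] Cn N) (T : Cn N →ₗ[ℝ] Cn N) := by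
    refine LinearMap.ext fun x => LinearMap.ext fun y => ?_
    simp [hpol]
  rw [h1, MeasureTheory.Measure.addHaar_preimage_linearMap _ hdet, metricDet, h2,
    det_toMatrix_comp, ← metricDet, Real.sqrt_mul (hB.metricDet_pos hz').le, Real.sqrt_sq_eq_abs,
    ENNReal.toReal_mul, ENNReal.toReal_ofReal (abs_nonneg _), abs_inv]
  field_simp [abs_ne_zero.2 hdet]

theorem differentiableAt_hessForm (hΦ : IsGauge Φ) (hv : v ≠ 0) (c d : Cn N) :
    DifferentiableAt ℝ (fun x : Cn N × Cn N => hessForm Φ (B x.1) x.2 c d) (z, v) := by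
  have hΦ' := hB.contDiffAt_gauge hΦ hz hv
  have h1 : DifferentiableAt ℝ (fderiv ℝ Φ) (B z v v) :=
    (hΦ'.fderiv_right (m := 1) (by norm_cast)).differentiableAt (by norm_num)
  have h2 : DifferentiableAt ℝ (fderiv ℝ (fderiv ℝ Φ)) (B z v v) :=
    ((hΦ'.fderiv_right (m := 2) (by norm_cast)).fderiv_right
      (m := 1) (by norm_num)).differentiableAt (by norm_num)
  have hB0 : ContDiffAt ℝ ∞ (fun x : Cn N × Cn N => B x.1) (z, v) :=
    ContDiffAt.comp (g := B) (z, v) (hB.contDiffAt hz) contDiffAt_fst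
  have hB' : DifferentiableAt ℝ (fun x : Cn N × Cn N => B x.1) (z, v) :=
    hB0.differentiableAt (by simp)
  have hs : DifferentiableAt ℝ (fun x : Cn N × Cn N => x.2) (z, v) := differentiableAt_snd
  have hq : DifferentiableAt ℝ (fun x : Cn N × Cn N => B x.1 x.2 x.2) (z, v) :=
    (hB'.clm_apply hs).clm_apply hs
  have k1 : DifferentiableAt ℝ (fun x : Cn N × Cn N => fderiv ℝ Φ (B x.1 x.2 x.2)) (z, v) :=
    DifferentiableAt.comp (f := fun x : Cn N × Cn N => B x.1 x.2 x.2) (z, v) h1 hq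
  have k2 : DifferentiableAt ℝ (fun x : Cn N × Cn N => fderiv ℝ (fderiv ℝ Φ) (B x.1 x.2 x.2))
      (z, v) :=
    DifferentiableAt.comp (g := fderiv ℝ (fderiv ℝ Φ))
      (f := fun x : Cn N × Cn N => B x.1 x.2 x.2) (z, v) h2 hq
  have kc : ∀ c, DifferentiableAt ℝ (fun x : Cn N × Cn N => B x.1 x.2 c) (z, v) :=
    fun c => (hB'.clm_apply hs).clm_apply (differentiableAt_const c)
  have kcd : DifferentiableAt ℝ (fun x : Cn N × Cn N => B x.1 c d) (z, v) :=
    (hB'.clm_apply (differentiableAt_const c)).clm_apply (differentiableAt_const d)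
  exact (k1.clm_apply (kcd.const_smul (2 : ℝ))).add
    (((k2.clm_apply (kc c)).clm_apply (kc d)).const_mul 4)

theorem differentiableAt_det_realHessian (hΦ : IsGauge Φ) (hv : v ≠ 0) :
    DifferentiableAt ℝ (fun x : Cn N × Cn N => (LinearMap.BilinForm.toMatrix (realBasisBasis N)
      (hessBilin Φ (B x.1) x.2)).det) (z, v) := by
  refine DifferentiableAt.matrix_det fun a b => ?_
  simp only [LinearMap.BilinForm.toMatrix_apply, hessBilin_apply]
  exact hB.differentiableAt_hessForm hz hΦ hv _ _

theorem differentiableAt_metricDet : DifferentiableAt ℝ (fun x => metricDet (B x)) z := by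
  refine DifferentiableAt.matrix_det fun a b => ?_
  simp only [LinearMap.BilinForm.toMatrix_apply, hessBilin_apply, hessForm_sumGauge,
    ← sumGauge_apply]
  have h := (hasFDerivAt_apply₂ (hB.differentiableAt hz) (realBasisBasis N a)
    (realBasisBasis N b)).differentiableAt
  exact ((sumGauge n).differentiableAt.comp z h).const_mul 2

/-- The map `x ↦ x - s Γ(e,x)` is parallel transport to first order in `s`, and compatibility of `Γ`
with `B` makes the derivative zero. -/
theorem hasDerivAt_transport {Γ : Cn N →L[ℝ] Cn N →L[ℝ] Cn N}
    (hΓ : ∀ x y w, fderiv ℝ B z x y w = B z (Γ x y) w + B z y (Γ x w)) (e x y : Cn N) :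
    HasDerivAt (fun s : ℝ => B (z + s • e) (x - s • Γ e x) (y - s • Γ e y)) 0 0 := by
  have h1 : HasDerivAt (fun s : ℝ => z + s • e) e 0 := by
    simpa using ((hasDerivAt_id (0 : ℝ)).smul_const e).const_add z
  have h2 : ∀ x, HasDerivAt (fun s : ℝ => x - s • Γ e x) (-Γ e x) 0 := fun x => by
    simpa using ((hasDerivAt_id (0 : ℝ)).smul_const (Γ e x)).const_sub x
  have hd : HasFDerivAt B (fderiv ℝ B z) (z + (0 : ℝ) • e) := by
    simpa using (hB.differentiableAt hz).hasFDerivAt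
  have h3 : HasDerivAt (fun s : ℝ => B (z + s • e)) (fderiv ℝ B z e) 0 :=
    HasFDerivAt.comp_hasDerivAt (f := fun s : ℝ => z + s • e) (l := B) 0 hd h1
  have h4 := (h3.clm_apply (h2 x)).clm_apply (h2 y)
  refine h4.congr_deriv ?_
  simp [hΓ]

/-- The Busemann-Hausdorff density is a constant multiple of `√(metricDet (B x))`. The constant `c`
also absorbs the factor 1/2 of the fundamental tensor. -/
theorem distortion_eq (hΦ : IsGauge Φ) : ∃ c : ℝ, ∀ x ∈ U, ∀ w, w ≠ 0 →
    distortion (fun z w => Φ (B z w w)) x w = Real.log (c *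
      √((LinearMap.BilinForm.toMatrix (realBasisBasis N) (hessBilin Φ (B x) w)).det /
        metricDet (B x))) := by
  refine ⟨√((1 / 2) ^ Fintype.card (Fin N ⊕ Fin N)) *
    ((MeasureTheory.volume {w : Cn N | Φ (B z w w) < 1}).toReal * √(metricDet (B z))) /
    (MeasureTheory.volume {w : Cn N | ∑ i, ‖w i‖ ^ 2 < 1}).toReal, fun x hx w hw => ?_⟩
  have hpos : 0 < √(metricDet (B x)) := Real.sqrt_pos.2 (hB.metricDet_pos hx)
  rw [hB.volume_mul_sqrt_metricDet hz hx, distortion, busemannHausdorff, fundamentalTensor,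
    Matrix.det_smul, hB.realHessian_eq hΦ hx hw, Real.sqrt_mul (by positivity),
    Real.sqrt_div' _ (hB.metricDet_pos hx).le]
  congr 1
  field_simp

include hΦ hv

theorem sCurvature_eq_zero : sCurvature (fun z w => Φ (B z w w)) z v = 0 := by
  obtain ⟨Γ, hΓ, hΓ'⟩ := hB.exists_connection hz
  rw [sCurvature, hB.sprayVector_eq_of hΦ hz hv (hB.spray_gauge hz (hΓ v))]
  obtain ⟨c, hc⟩ := hB.distortion_eq hz hΦ
  set D : Cn N × Cn N → ℝ := fun x => (LinearMap.BilinForm.toMatrix (realBasisBasis N)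
      (hessBilin Φ (B x.1) x.2)).det with hD
  have hDpos : ∀ x ∈ U, ∀ w, w ≠ 0 → 0 < D (x, w) := fun x hx w hw => by
    have := (hB.posDef_realHessian hΦ hx hw).det_pos
    rwa [hB.realHessian_eq hΦ hx hw] at this
  set τ : Cn N × Cn N → ℝ := fun x => Real.log (c * √(D x / metricDet (B x.1))) with hτ
  have hdiv : 0 < D (z, v) / metricDet (B z) := div_pos (hDpos z hz v hv) (hB.metricDet_pos hz)
  -- For `c = 0` the function is constant, as `Real.log 0 = 0`; no positivity of the volumes is
  -- therefore needed.
  have hlog : ∀ {r : ℝ}, 0 < r → DifferentiableAt ℝ (fun r => Real.log (c * √r)) r := by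
    intro r hr
    rcases eq_or_ne c 0 with rfl | hc0
    · simp
    · exact ((differentiableAt_id.sqrt hr.ne').const_mul c).log
        (mul_ne_zero hc0 (Real.sqrt_pos.2 hr).ne')
  have hdiff : DifferentiableAt ℝ (fun x : Cn N × Cn N => D x / metricDet (B x.1)) (z, v) := by
    have h : DifferentiableAt ℝ (fun x : Cn N × Cn N => metricDet (B x.1)) (z, v) :=
      DifferentiableAt.comp (g := fun x => metricDet (B x)) (f := Prod.fst) (z, v)
        (hB.differentiableAt_metricDet hz) differentiableAt_fst
    have h' : (fun x : Cn N × Cn N => metricDet (B x.1)) (z, v) ≠ 0 := (hB.metricDet_pos hz).ne'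
    simp only [div_eq_mul_inv]
    exact (hB.differentiableAt_det_realHessian hz hΦ hv).mul (h.inv h')
  have hτd : HasFDerivAt τ (fderiv ℝ τ (z, v)) (z, v) :=
    (DifferentiableAt.comp (f := fun x : Cn N × Cn N => D x / metricDet (B x.1)) (z, v)
      (hlog hdiv) hdiff).hasFDerivAt
  have h1 : fderiv ℝ (fun z' => distortion (fun z w => Φ (B z w w)) z' v) z v =
      fderiv ℝ τ (z, v) (v, 0) := by
    have he : (fun z' => distortion (fun z w => Φ (B z w w)) z' v) =ᶠ[𝓝 z] fun z' => τ (z', v) := by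
      filter_upwards [hB.isOpen.mem_nhds hz] with x hx using hc x hx v hv
    have h : HasFDerivAt (fun z' => τ (z', v)) _ z := HasFDerivAt.comp (f := fun x => (x, v)) z hτd
      ((hasFDerivAt_id z).prodMk (hasFDerivAt_const v z))
    rw [he.fderiv_eq, h.fderiv]
    simp
  have h2 : fderiv ℝ (distortion (fun z w => Φ (B z w w)) z) v (Γ v v) =
      fderiv ℝ τ (z, v) (0, Γ v v) := by
    have he : distortion (fun z w => Φ (B z w w)) z =ᶠ[𝓝 v] fun w => τ (z, w) := by
      filter_upwards [isOpen_ne.mem_nhds hv] with w hw using hc z hz w hw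
    have h : HasFDerivAt (fun w => τ (z, w)) _ v := HasFDerivAt.comp (f := fun w => (z, w)) v hτd
      ((hasFDerivAt_const z v).prodMk (hasFDerivAt_id v))
    rw [he.fderiv_eq, h.fderiv]
    simp
  rw [h1, h2, ← map_sub, Prod.mk_sub_mk, sub_zero, zero_sub]
  -- First-order parallel transport along `v`. The curve `(z + s v, L s v)` leaves `(z, v)` with
  -- velocity `(v, -Γ(v,v))`, the direction in which the S-curvature differentiates `τ`.
  let L : ℝ → Cn N →ₗ[ℝ] Cn N := fun s => LinearMap.id - s • (Γ v : Cn N →ₗ[ℝ] Cn N)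
  have hL : ∀ s x, L s x = x - s • Γ v x := fun s x => rfl
  have hcurve : HasDerivAt (fun s : ℝ => (z + s • v, L s v)) (v, -Γ v v) 0 := by
    refine HasDerivAt.prodMk ?_ ?_
    · simpa using ((hasDerivAt_id (0 : ℝ)).smul_const v).const_add z
    · simpa [hL] using ((hasDerivAt_id (0 : ℝ)).smul_const (Γ v v)).const_sub v
  have h0 : (z + (0 : ℝ) • v, L 0 v) = (z, v) := by simp [hL]
  have hL0 : L 0 = LinearMap.id := by ext; simp [L]
  have htr := hB.hasDerivAt_transport hz hΓ' v
  -- Pulling the Hessian back by `L s` makes its entries stationary and multiplies its determinant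
  -- by `det (L s) ^ 2`. The same factor appears for `metricDet` and cancels in the quotient.
  have hP : HasDerivAt (fun s : ℝ => D (z + s • v, L s v) * LinearMap.det (L s) ^ 2) 0 0 := by
    have : (fun s : ℝ => D (z + s • v, L s v) * LinearMap.det (L s) ^ 2) = fun s =>
        (LinearMap.BilinForm.toMatrix (realBasisBasis N)
          (LinearMap.BilinForm.comp (hessBilin Φ (B (z + s • v)) (L s v)) (L s) (L s))).det := by
      funext s
      rw [det_toMatrix_comp]
    rw [this]
    refine HasDerivAt.matrix_det_zero fun a b => ?_
    simp only [LinearMap.BilinForm.toMatrix_apply, LinearMap.BilinForm.comp_apply,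
      hessBilin_apply, hL]
    refine hasDerivAt_hessForm_zero ?_ (htr _ _) (htr _ _) (htr _ _) (htr _ _)
    simpa using hB.contDiffAt_gauge hΦ hz hv
  have hR : HasDerivAt (fun s : ℝ => metricDet (B (z + s • v)) * LinearMap.det (L s) ^ 2) 0 0 := by
    have : (fun s : ℝ => metricDet (B (z + s • v)) * LinearMap.det (L s) ^ 2) = fun s =>
        (LinearMap.BilinForm.toMatrix (realBasisBasis N)
          (LinearMap.BilinForm.comp (hessBilin (sumGauge n) (B (z + s • v)) 0)
            (L s) (L s))).det := by
      funext s
      rw [det_toMatrix_comp, metricDet]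
    rw [this]
    refine HasDerivAt.matrix_det_zero fun a b => ?_
    simp only [LinearMap.BilinForm.toMatrix_apply, LinearMap.BilinForm.comp_apply,
      hessBilin_apply, hessForm_sumGauge, hL, ← sumGauge_apply]
    simpa using (((sumGauge n).hasFDerivAt.comp_hasDerivAt (0 : ℝ) (htr (realBasisBasis N a)
      (realBasisBasis N b))).const_mul 2)
  have hRpos : metricDet (B (z + (0 : ℝ) • v)) * LinearMap.det (L 0) ^ 2 ≠ 0 := by
    rw [hL0, LinearMap.det_id, zero_smul, add_zero, one_pow, mul_one]
    exact (hB.metricDet_pos hz).ne'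
  have hdet : ∀ᶠ s in 𝓝 (0 : ℝ), metricDet (B (z + s • v)) * LinearMap.det (L s) ^ 2 ≠ 0 :=
    hR.continuousAt.eventually_ne hRpos
  have hquot : HasDerivAt (fun s : ℝ => D (z + s • v, L s v) / metricDet (B (z + s • v))) 0 0 := by
    have h := hP.div hR hRpos
    simp only [zero_mul, mul_zero, sub_zero, zero_div] at h
    refine h.congr_of_eventuallyEq ?_
    filter_upwards [hdet] with s hs
    simp only [Pi.div_apply]
    exact (mul_div_mul_right _ _ (right_ne_zero_of_mul hs)).symm
  have hτ0 : HasDerivAt (fun s : ℝ => τ (z + s • v, L s v)) 0 0 := by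
    have hp : 0 < D (z + (0 : ℝ) • v, L 0 v) / metricDet (B (z + (0 : ℝ) • v)) := by
      rw [h0, zero_smul, add_zero]
      exact hdiv
    have h := (hlog hp).hasDerivAt.comp (0 : ℝ) hquot
    rw [mul_zero] at h
    exact h
  have hτ1 : HasDerivAt (fun s : ℝ => τ (z + s • v, L s v)) (fderiv ℝ τ (z, v) (v, -Γ v v)) 0 :=
    HasFDerivAt.comp_hasDerivAt (f := fun s : ℝ => (z + s • v, L s v)) (l := τ) 0
      (by rwa [h0]) hcurve
  exact hτ1.unique hτ0

end IsSplitForm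

end Distortion

/-! ### The gauge that defines `Ftk`. -/

section PowerGauge

variable {n : ℕ}

/-- The function `(1 + t)⁻¹ (∑ x_l + t (∑ x_l^k)^{1/k})`. -/
def powerGauge (n : ℕ) (t : ℝ) (k : ℕ) (x : Fin n → ℝ) : ℝ :=
  1 / (1 + t) * (∑ l, x l + t * (∑ l, x l ^ k) ^ (1 / (k : ℝ)))

theorem continuous_powerGauge (t : ℝ) (k : ℕ) : Continuous (powerGauge n t k) := by
  unfold powerGauge
  refine continuous_const.mul (Continuous.add (by fun_prop) (continuous_const.mul ?_))
  exact Continuous.rpow_const (by fun_prop) fun x => Or.inr (by positivity)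

theorem contDiffAt_powerGauge (t : ℝ) (k : ℕ) {x : Fin n → ℝ} (hx : 0 < ∑ l, x l ^ k) :
    ContDiffAt ℝ ∞ (powerGauge n t k) x := by
  unfold powerGauge
  refine contDiffAt_const.mul (ContDiffAt.add (by fun_prop) (contDiffAt_const.mul ?_))
  exact ContDiffAt.rpow_const_of_ne (by fun_prop) hx.ne'

theorem fderiv_apply_eq_of_line {E F : Type*} [NormedAddCommGroup E] [NormedSpace ℝ E]
    [NormedAddCommGroup F] [NormedSpace ℝ F] {f : E → F} {x y : E} {f' : F}
    (hf : DifferentiableAt ℝ f x) (h : HasDerivAt (fun r : ℝ => f (x + r • y)) f' 0) :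
    fderiv ℝ f x y = f' :=
  HasDerivAt.unique (hf.hasFDerivAt.hasLineDerivAt y) h

theorem hasDerivAt_sum_pow_line (k : ℕ) (x y : Fin n → ℝ) :
    HasDerivAt (fun r : ℝ => ∑ l, (x + r • y) l ^ k) (∑ l, k * x l ^ (k - 1) * y l) 0 := by
  refine HasDerivAt.fun_sum fun l _ => ?_
  have h : HasDerivAt (fun r : ℝ => (x + r • y) l) (y l) 0 := by
    simpa using ((hasDerivAt_id (0 : ℝ)).mul_const (y l)).const_add (x l)
  simpa using h.fun_pow k

theorem fderiv_powerGauge (t : ℝ) {k : ℕ} (hk : 2 ≤ k) {x : Fin n → ℝ} (hx : 0 < ∑ l, x l ^ k)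
    (y : Fin n → ℝ) :
    fderiv ℝ (powerGauge n t k) x y = 1 / (1 + t) *
      (∑ l, y l + t * ((∑ l, x l ^ k) ^ (1 / (k : ℝ) - 1) * ∑ l, x l ^ (k - 1) * y l)) := by
  refine fderiv_apply_eq_of_line
    ((contDiffAt_powerGauge t k hx).differentiableAt (by simp)) ?_
  have hP := hasDerivAt_sum_pow_line k x y
  have h1 : HasDerivAt (fun r : ℝ => ∑ l, (x + r • y) l) (∑ l, y l) 0 := by
    refine HasDerivAt.fun_sum fun l _ => ?_
    simpa using ((hasDerivAt_id (0 : ℝ)).mul_const (y l)).const_add (x l)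
  have h0 : ∑ l, (x + (0 : ℝ) • y) l ^ k = ∑ l, x l ^ k := by simp
  have h2 := hP.rpow_const (p := 1 / (k : ℝ)) (Or.inl (by rw [h0]; exact hx.ne'))
  have h := (h1.add (h2.const_mul t)).const_mul (1 / (1 + t))
  refine h.congr_deriv ?_
  have hk0 : (k : ℝ) ≠ 0 := by positivity
  simp only [zero_smul, add_zero, mul_assoc, ← Finset.mul_sum]
  field_simp

theorem fderiv_fderiv_powerGauge (t : ℝ) {k : ℕ} (hk : 2 ≤ k) {x : Fin n → ℝ}
    (hx : 0 < ∑ l, x l ^ k) (b : Fin n → ℝ) :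
    fderiv ℝ (fderiv ℝ (powerGauge n t k)) x b b = 1 / (1 + t) * (t * ((k - 1) *
      (∑ l, x l ^ k) ^ (1 / (k : ℝ) - 1 - 1) * ((∑ l, x l ^ k) * ∑ l, x l ^ (k - 2) * b l ^ 2 -
        (∑ l, x l ^ (k - 1) * b l) ^ 2))) := by
  have hd : DifferentiableAt ℝ (fderiv ℝ (powerGauge n t k)) x :=
    ((contDiffAt_powerGauge t k hx).fderiv_right (m := 1) (by norm_cast)).differentiableAt
      (by norm_num)
  have h0 : fderiv ℝ (fderiv ℝ (powerGauge n t k)) x b b =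
      fderiv ℝ (fun x => fderiv ℝ (powerGauge n t k) x b) x b := by
    rw [(hd.hasFDerivAt.clm_apply (hasFDerivAt_const b x)).fderiv]
    simp
  rw [h0]
  refine fderiv_apply_eq_of_line (hd.clm_apply (differentiableAt_const b)) ?_
  have hP := hasDerivAt_sum_pow_line k x b
  have hP0 : ∑ l, (x + (0 : ℝ) • b) l ^ k = ∑ l, x l ^ k := by simp
  have h1 := hP.rpow_const (p := 1 / (k : ℝ) - 1) (Or.inl (by rw [hP0]; exact hx.ne'))
  have h2 : HasDerivAt (fun r : ℝ => ∑ l, (x + r • b) l ^ (k - 1) * b l)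
      (∑ l, (k - 1 : ℕ) * x l ^ (k - 1 - 1) * b l * b l) 0 := by
    refine HasDerivAt.fun_sum fun l _ => ?_
    have h : HasDerivAt (fun r : ℝ => (x + r • b) l) (b l) 0 := by
      simpa using ((hasDerivAt_id (0 : ℝ)).mul_const (b l)).const_add (x l)
    simpa using (h.fun_pow (k - 1)).mul_const (b l)
  have h := (((h1.mul h2).const_mul t).const_add (∑ l, b l)).const_mul (1 / (1 + t))
  have hev : (fun r : ℝ => fderiv ℝ (powerGauge n t k) (x + r • b) b) =ᶠ[𝓝 0] fun r : ℝ =>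
      1 / (1 + t) * (∑ l, b l + t * ((∑ l, (x + r • b) l ^ k) ^ (1 / (k : ℝ) - 1) *
        ∑ l, (x + r • b) l ^ (k - 1) * b l)) := by
    have : ∀ᶠ r in 𝓝 (0 : ℝ), 0 < ∑ l, (x + r • b) l ^ k :=
      hP.continuousAt.eventually (lt_mem_nhds (by simpa using hx))
    filter_upwards [this] with r hr
    exact fderiv_powerGauge t hk hr b
  refine (h.congr_of_eventuallyEq hev).congr_deriv ?_
  have hk0 : (k : ℝ) ≠ 0 := by positivity
  -- Brings both terms of the product rule to the exponent `1/k - 2`, leaving the Cauchy-Schwarz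
  -- difference as a factor.
  have e1 : (∑ l, x l ^ k) ^ (1 / (k : ℝ) - 1) =
      (∑ l, x l ^ k) ^ (1 / (k : ℝ) - 1 - 1) * ∑ l, x l ^ k := by
    rw [Real.rpow_sub_one hx.ne' (1 / (k : ℝ) - 1)]
    field_simp
  have e2 : ((k - 1 : ℕ) : ℝ) = k - 1 := by
    rw [Nat.cast_sub (by omega), Nat.cast_one]
  have e3 : ∑ l, x l ^ (k - 1 - 1) * (b l * b l) = ∑ l, x l ^ (k - 2) * b l ^ 2 :=
    Finset.sum_congr rfl fun l _ => by rw [Nat.sub_sub, sq]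
  simp only [zero_smul, add_zero, mul_assoc, ← Finset.mul_sum, e2]
  rw [e1, e3]
  field_simp
  ring

theorem sum_pow_pos {k : ℕ} {x : Fin n → ℝ} (h0 : 0 ≤ x) (hx : x ≠ 0) : 0 < ∑ l, x l ^ k := by
  obtain ⟨l, hl⟩ := Function.ne_iff.1 hx
  exact Finset.sum_pos' (fun l _ => pow_nonneg (h0 l) k)
    ⟨l, Finset.mem_univ l, pow_pos (lt_of_le_of_ne (h0 l) (Ne.symm hl)) k⟩

theorem isGauge_powerGauge {t : ℝ} (ht : 0 ≤ t) {k : ℕ} (hk : 2 ≤ k) :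
    IsGauge (powerGauge n t k) where
  smooth x h0 hx := contDiffAt_powerGauge t k (sum_pow_pos h0 hx)
  pos x y b h0 hx hy hy' := by
    have hP := sum_pow_pos (k := k) h0 hx
    have hk1 : (0 : ℝ) ≤ k - 1 := by
      have : (2 : ℝ) ≤ k := by exact_mod_cast hk
      linarith
    have hsum : 0 < ∑ l, y l := by simpa using sum_pow_pos (k := 1) hy hy'
    -- Cauchy-Schwarz, from `(x^(k-1) b)² = x^k · x^(k-2) b²`. It makes the second derivative
    -- nonnegative; strict positivity comes from `∑ y_l` in the first derivative, for `t = 0` as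
    -- well.
    have hcs : (∑ l, x l ^ (k - 1) * b l) ^ 2 ≤
        (∑ l, x l ^ k) * ∑ l, x l ^ (k - 2) * b l ^ 2 := by
      refine Finset.sum_sq_le_sum_mul_sum_of_sq_le_mul _ (fun l _ => pow_nonneg (h0 l) k)
        (fun l _ => mul_nonneg (pow_nonneg (h0 l) _) (sq_nonneg _)) fun l _ => le_of_eq ?_
      obtain ⟨j, rfl⟩ := Nat.exists_eq_add_of_le hk
      rw [show 2 + j - 1 = j + 1 by omega, show 2 + j - 2 = j by omega]
      ring
    have hfst : 0 ≤ ∑ l, x l ^ (k - 1) * y l :=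
      Finset.sum_nonneg fun l _ => mul_nonneg (pow_nonneg (h0 l) _) (hy l)
    rw [fderiv_powerGauge t hk hP, fderiv_fderiv_powerGauge t hk hP]
    have h1 : 0 ≤ (∑ l, x l ^ k) ^ (1 / (k : ℝ) - 1) := Real.rpow_nonneg hP.le _
    have h2 : 0 ≤ (∑ l, x l ^ k) ^ (1 / (k : ℝ) - 1 - 1) := Real.rpow_nonneg hP.le _
    have h3 := sub_nonneg.2 hcs
    positivity

theorem powerGauge_pos {t : ℝ} (ht : 0 ≤ t) (k : ℕ) {x : Fin n → ℝ} (h0 : 0 ≤ x) (hx : x ≠ 0) :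
    0 < powerGauge n t k x := by
  have hsum : 0 < ∑ l, x l := by simpa using sum_pow_pos (k := 1) h0 hx
  have h1 : 0 ≤ (∑ l, x l ^ k) ^ (1 / (k : ℝ)) := Real.rpow_nonneg (sum_pow_pos h0 hx).le _
  unfold powerGauge
  positivity

theorem powerGauge_zero (t : ℝ) {k : ℕ} (hk : 2 ≤ k) : powerGauge n t k 0 = 0 := by
  have hk0 : k ≠ 0 := by omega
  simp [powerGauge, hk0]

theorem powerGauge_nonneg {t : ℝ} (ht : 0 ≤ t) {k : ℕ} (hk : 2 ≤ k) {x : Fin n → ℝ}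
    (h0 : 0 ≤ x) : 0 ≤ powerGauge n t k x := by
  rcases eq_or_ne x 0 with rfl | hx
  · exact (powerGauge_zero t hk).ge
  · exact (powerGauge_pos ht k h0 hx).le

theorem powerGauge_smul (t : ℝ) {k : ℕ} (hk : 2 ≤ k) {r : ℝ} (hr : 0 ≤ r) {x : Fin n → ℝ}
    (h0 : 0 ≤ x) : powerGauge n t k (r • x) = r * powerGauge n t k x := by
  have hk0 : k ≠ 0 := by omega
  have h1 : 0 ≤ ∑ l, x l ^ k := Finset.sum_nonneg fun l _ => pow_nonneg (h0 l) k
  have h2 : (r ^ k) ^ (1 / (k : ℝ)) = r := by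
    rw [one_div, Real.pow_rpow_inv_natCast hr hk0]
  simp only [powerGauge, Pi.smul_apply, smul_eq_mul, mul_pow, ← Finset.mul_sum]
  rw [Real.mul_rpow (pow_nonneg hr k) h1, h2]
  ring

end PowerGauge

/-! ### Isometries between positive definite forms -/

section Isometry

variable {V : Type*} [AddCommGroup V] [Module ℝ V] [FiniteDimensional ℝ V]

/-- Diagonalization with weights 1, 0, -1; positivity at the preimages of the unit vectors leaves
only the weight 1. -/
theorem exists_linearEquiv_sum_sq (A : V →ₗ[ℝ] V →ₗ[ℝ] ℝ) (hA : ∀ v, v ≠ 0 → 0 < A v v) :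
    ∃ T : V ≃ₗ[ℝ] (Fin (Module.finrank ℝ V) → ℝ), ∀ v, A v v = ∑ i, T v i ^ 2 := by
  obtain ⟨w, hw, ⟨T⟩⟩ := QuadraticForm.equivalent_one_zero_neg_one_weighted_sum_squared
    (LinearMap.BilinMap.toQuadraticMap A)
  have hT : ∀ v, A v v = ∑ i, w i * (T v i * T v i) := fun v => by
    have h := T.map_app v
    rw [QuadraticMap.weightedSumSquares_apply] at h
    exact h.symm
  have hw1 : ∀ i, w i = 1 := fun i => by
    have hne : T.toLinearEquiv.symm (Pi.single i 1) ≠ 0 := by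
      rw [Ne, LinearEquiv.map_eq_zero_iff, Pi.single_eq_zero_iff]
      exact one_ne_zero
    have h := hA _ hne
    have hs : T (T.toLinearEquiv.symm (Pi.single i 1)) = Pi.single i 1 :=
      T.toLinearEquiv.apply_symm_apply _
    rw [hT, hs, Finset.sum_eq_single i (fun j _ hj => by simp [Pi.single_eq_of_ne hj]) (by simp),
      Pi.single_eq_same, mul_one, mul_one] at h
    rcases hw i with h' | h' | h' <;> rw [h'] at h ⊢ <;> linarith
  refine ⟨T.toLinearEquiv, fun v => ?_⟩
  rw [hT]
  exact Finset.sum_congr rfl fun i _ => by rw [hw1, one_mul, sq]; rfl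

theorem exists_isometry (A A' : V →ₗ[ℝ] V →ₗ[ℝ] ℝ) (hA : ∀ v, v ≠ 0 → 0 < A v v)
    (hA' : ∀ v, v ≠ 0 → 0 < A' v v) : ∃ T : V ≃ₗ[ℝ] V, ∀ v, A' (T v) (T v) = A v v := by
  obtain ⟨S, hS⟩ := exists_linearEquiv_sum_sq A hA
  obtain ⟨S', hS'⟩ := exists_linearEquiv_sum_sq A' hA'
  exact ⟨S.trans S'.symm, fun v => by rw [hS, hS']; simp⟩

end Isometry

/-! ### Pull-backs of forms under holomorphic maps -/

section Pullback

variable {N m : ℕ} {K : Cn m → Cn m →L[ℝ] Cn m →L[ℝ] ℝ} {f : Cn N → Cn m} {z : Cn N}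

theorem hasFDerivAt_fderiv_apply (hf : ContDiffAt ℂ ω f z) (v : Cn N) :
    HasFDerivAt (fun x => fderiv ℂ f x v)
      (((fderiv ℂ (fderiv ℂ f) z).flip v).restrictScalars ℝ) z := by
  have h : DifferentiableAt ℂ (fderiv ℂ f) z :=
    (hf.fderiv_right (m := 1) le_top).differentiableAt (by norm_num)
  have h' := h.hasFDerivAt.clm_apply (hasFDerivAt_const v z)
  refine (h'.congr_fderiv ?_).restrictScalars ℝ
  ext c
  simp

theorem hasFDerivAt_pullback (hf : ContDiffAt ℂ ω f z) (hK : DifferentiableAt ℝ K (f z))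
    (v w : Cn N) :
    ∃ L : Cn N →L[ℝ] ℝ, HasFDerivAt (fun x => K (f x) (fderiv ℂ f x v) (fderiv ℂ f x w)) L z ∧
      ∀ e, L e = fderiv ℝ K (f z) (fderiv ℂ f z e) (fderiv ℂ f z v) (fderiv ℂ f z w) +
        K (f z) (fderiv ℂ (fderiv ℂ f) z e v) (fderiv ℂ f z w) +
        K (f z) (fderiv ℂ f z v) (fderiv ℂ (fderiv ℂ f) z e w) := by
  have hf' : HasFDerivAt f ((fderiv ℂ f z).restrictScalars ℝ) z :=
    (hf.differentiableAt (by simp)).hasFDerivAt.restrictScalars ℝ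
  have h1 : HasFDerivAt (fun x => K (f x)) _ z :=
    HasFDerivAt.comp (f := f) (g := K) z hK.hasFDerivAt hf'
  have h2 := (h1.clm_apply (hasFDerivAt_fderiv_apply hf v)).clm_apply
    (hasFDerivAt_fderiv_apply hf w)
  refine ⟨_, h2, fun e => ?_⟩
  simp
  ring

theorem contDiffAt_pullback (hf : ContDiffAt ℂ ω f z) (hK : ContDiffAt ℝ ∞ K (f z))
    (v w : Cn N) :
    ContDiffAt ℝ ∞ (fun x => K (f x) (fderiv ℂ f x v) (fderiv ℂ f x w)) z := by
  have hf' : ContDiffAt ℝ ∞ f z := (hf.restrict_scalars ℝ).of_le le_top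
  have h1 : ContDiffAt ℝ ∞ (fun x => K (f x)) z := ContDiffAt.comp (g := K) z hK hf'
  have h2 : ∀ v, ContDiffAt ℝ ∞ (fun x => fderiv ℂ f x v) z := fun v => by
    have h : ContDiffAt ℂ ω (fun x => fderiv ℂ f x v) z :=
      (hf.fderiv_right (m := ω) le_top).clm_apply contDiffAt_const
    exact (h.restrict_scalars ℝ).of_le le_top
  exact (h1.clm_apply (h2 v)).clm_apply (h2 w)

/-- Here `f` stands for a projection and `d` for a vector in its kernel. All terms with `Df d`
vanish; those that remain contain second derivatives of `f` and agree by their symmetry. -/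
theorem fderiv_pullback_self (hf : ContDiffAt ℂ ω f z) (hK : DifferentiableAt ℝ K (f z))
    (hs : ∀ v w, K (f z) v w = K (f z) w v) {v d : Cn N} (hd : fderiv ℂ f z d = 0) :
    2 * fderiv ℝ (fun x => K (f x) (fderiv ℂ f x v) (fderiv ℂ f x d)) z v =
      fderiv ℝ (fun x => K (f x) (fderiv ℂ f x v) (fderiv ℂ f x v)) z d := by
  obtain ⟨L₁, hL₁, h₁⟩ := hasFDerivAt_pullback hf hK v d
  obtain ⟨L₂, hL₂, h₂⟩ := hasFDerivAt_pullback hf hK v v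
  have hsymm : IsSymmSndFDerivAt ℂ f z := hf.isSymmSndFDerivAt (by simp)
  rw [hL₁.fderiv, hL₂.fderiv, h₁, h₂, hd, hs (fderiv ℂ (fderiv ℂ f) z d v), hsymm.eq d v]
  simp
  ring

/-- The surviving terms contain `D²f(e,d)` and `D²f(ie,id)`, which are opposite because `f` is
holomorphic. -/
theorem fderiv_pullback_I (hf : ContDiffAt ℂ ω f z) (hK : DifferentiableAt ℝ K (f z))
    {v d : Cn N} (hd : fderiv ℂ f z d = 0) (e : Cn N) :
    fderiv ℝ (fun x => K (f x) (fderiv ℂ f x v) (fderiv ℂ f x d)) z e +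
      fderiv ℝ (fun x => K (f x) (fderiv ℂ f x v) (fderiv ℂ f x (Complex.I • d))) z
        (Complex.I • e) = 0 := by
  obtain ⟨L₁, hL₁, h₁⟩ := hasFDerivAt_pullback hf hK v d
  obtain ⟨L₂, hL₂, h₂⟩ := hasFDerivAt_pullback hf hK v (Complex.I • d)
  have h : fderiv ℂ (fderiv ℂ f) z (Complex.I • e) (Complex.I • d) =
      -fderiv ℂ (fderiv ℂ f) z e d := by
    rw [map_smul, map_smul, smul_apply, I_smul_I_smul]
  have hd' : fderiv ℂ f z (Complex.I • d) = 0 := by rw [map_smul, hd, smul_zero]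
  rw [hL₁.fderiv, hL₂.fderiv, h₁, h₂, hd', hd, h]
  simp only [map_zero, map_neg, add_zero, zero_add, add_neg_cancel]

end Pullback

/-! ### Hermitian metrics in charts -/

section Chart

variable {N : ℕ} {M : Type*} [TopologicalSpace M] [ChartedSpace (Cn N) M]

/-- The real part of a Hermitian metric at a point. -/
def HermitianMetric.realForm (Q : HermitianMetric N M) (p : M) : Cn N →ₗ[ℝ] Cn N →ₗ[ℝ] ℝ :=
  let f : Cn N →ₗ[ℂ] Cn N →ₗ⋆[ℂ] ℂ := Q.form p
  LinearMap.mk₂ ℝ (fun v w => (f v w).re)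
    (fun v v' w => by simp)
    (fun r v w => by
      rw [← Complex.coe_smul r v, map_smul]
      simp)
    (fun v w w' => by simp)
    (fun r v w => by
      rw [← Complex.coe_smul r w, LinearMap.map_smulₛₗ]
      simp)

theorem HermitianMetric.realForm_apply (Q : HermitianMetric N M) (p : M) (v w : Cn N) :
    Q.realForm p v w = (Q.form p v w).re := rfl

theorem HermitianMetric.realForm_symm (Q : HermitianMetric N M) (p : M) (v w : Cn N) :
    Q.realForm p v w = Q.realForm p w v := by
  rw [realForm_apply, realForm_apply, ← Q.conj_symm p v w]
  simp

theorem HermitianMetric.realForm_I (Q : HermitianMetric N M) (p : M) (v w : Cn N) :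
    Q.realForm p (Complex.I • v) (Complex.I • w) = Q.realForm p v w := by
  let f : Cn N →ₗ[ℂ] Cn N →ₗ⋆[ℂ] ℂ := Q.form p
  change (f (Complex.I • v) (Complex.I • w)).re = (f v w).re
  rw [LinearMap.map_smulₛₗ, map_smul]
  simp

/-- Conjugate linearity in `w` expresses the imaginary part at `w` as the real part at `iw`. -/
theorem HermitianMetric.form_eq (Q : HermitianMetric N M) (p : M) (v w : Cn N) :
    Q.form p v w = antilin (Q.realForm p v) w := by
  let f : Cn N →ₗ[ℂ] Cn N →ₗ⋆[ℂ] ℂ := Q.form p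
  change f v w = (f v w).re + Complex.I * (f v (Complex.I • w)).re
  rw [LinearMap.map_smulₛₗ]
  apply Complex.ext <;> simp

theorem HermitianMetric.realForm_pos (Q : HermitianMetric N M) (p : M) {v : Cn N} (hv : v ≠ 0) :
    0 < Q.realForm p v v := Q.pos p v hv

theorem HermitianMetric.realForm_nonneg (Q : HermitianMetric N M) (p : M) (v : Cn N) :
    0 ≤ Q.realForm p v v := by
  rcases eq_or_ne v 0 with rfl | hv
  · simp
  · exact (Q.realForm_pos p hv).le

variable {e : OpenPartialHomeomorph M (Cn N)}

theorem IsHolomorphicChart.mdifferentiable (he : IsHolomorphicChart N M e) :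
    e.MDifferentiable 𝓘(ℂ, Cn N) 𝓘(ℂ, Cn N) :=
  ⟨(contMDiffOn_of_mem_maximalAtlas he).mdifferentiableOn (by simp),
    (contMDiffOn_symm_of_mem_maximalAtlas he).mdifferentiableOn (by simp)⟩

/-- The differential of the inverse of a chart. -/
def chartDifferential (e : OpenPartialHomeomorph M (Cn N)) (z : Cn N) : Cn N →L[ℂ] Cn N :=
  mfderiv 𝓘(ℂ, Cn N) 𝓘(ℂ, Cn N) e.symm z

theorem bijective_chartDifferential (he : IsHolomorphicChart N M e) {z : Cn N}
    (hz : z ∈ e.target) : Function.Bijective (chartDifferential e z) :=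
  he.mdifferentiable.symm.mfderiv_bijective hz

/-- The real part of a Hermitian metric in a chart. -/
def HermitianMetric.chartForm (Q : HermitianMetric N M) (e : OpenPartialHomeomorph M (Cn N))
    (z : Cn N) : Cn N →L[ℝ] Cn N →L[ℝ] ℝ :=
  ((Q.realForm (e.symm z)).compl₁₂ ((chartDifferential e z).restrictScalars ℝ : Cn N →ₗ[ℝ] Cn N)
    ((chartDifferential e z).restrictScalars ℝ : Cn N →ₗ[ℝ] Cn N)).toContinuousBilinearMap

theorem HermitianMetric.chartForm_apply (Q : HermitianMetric N M)
    (e : OpenPartialHomeomorph M (Cn N)) (z v w : Cn N) :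
    Q.chartForm e z v w =
      Q.realForm (e.symm z) (chartDifferential e z v) (chartDifferential e z w) := rfl

theorem HermitianMetric.contDiffOn_chartForm (Q : HermitianMetric N M)
    (he : IsHolomorphicChart N M e) : ContDiffOn ℝ ∞ (Q.chartForm e) e.target := by
  rw [contDiffOn_clm_apply]
  intro v
  rw [contDiffOn_clm_apply]
  intro w
  have h : ∀ z, Q.chartForm e z v w = (∑ α, ∑ β, v α * (star (w β) * Q.coeff e α β z)).re := by
    intro z
    let f : Cn N →ₗ[ℂ] Cn N →ₗ⋆[ℂ] ℂ := Q.form (e.symm z)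
    let D := chartDifferential e z
    change (f (D v) (D w)).re = (∑ α, ∑ β, v α * (star (w β) *
      f (D (Pi.single α 1)) (D (Pi.single β 1)))).re
    congr 1
    have hsum : ∀ v : Cn N, D v = ∑ α, v α • D (Pi.single α 1) := fun v => by
      conv_lhs => rw [← sum_single_smul v, map_sum]
      simp [realBasis]
    rw [hsum v, hsum w]
    simp only [map_sum, LinearMap.sum_apply, map_smul, LinearMap.smul_apply,
      LinearMap.map_smulₛₗ, smul_eq_mul]
    rw [Finset.sum_comm]
    refine Finset.sum_congr rfl fun β _ => ?_
    rw [Finset.mul_sum]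
    exact Finset.sum_congr rfl fun α _ => by rw [starRingEnd_apply]; ring
  simp only [h]
  refine Complex.reCLM.contDiff.comp_contDiffOn ?_
  exact ContDiffOn.sum fun α _ => ContDiffOn.sum fun β _ =>
    contDiffOn_const.mul (contDiffOn_const.mul (Q.smooth e he α β))

end Chart

/-! ### Product decompositions in charts -/

section Decomposition

variable {n N : ℕ} {m : Fin n → ℕ}
  {M : Type*} [TopologicalSpace M] [ChartedSpace (Cn N) M]
  {X : Fin n → Type*} [∀ l, TopologicalSpace (X l)] [∀ l, ChartedSpace (Cn (m l)) (X l)]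

/-- The differential of `π_l` in a chart of `M`. -/
def projDifferential (π : ∀ l, M → X l) (e : OpenPartialHomeomorph M (Cn N)) (l : Fin n)
    (z : Cn N) : Cn N →L[ℂ] Cn (m l) :=
  (show Cn N →L[ℂ] Cn (m l) from mfderiv 𝓘(ℂ, Cn N) 𝓘(ℂ, Cn (m l)) (π l) (e.symm z)).comp
    (chartDifferential e z)

/-- The real parts of the Hermitian metrics of the factors, in a chart of `M`. -/
def splitForm (Ql : ∀ l, HermitianMetric (m l) (X l)) (π : ∀ l, M → X l)
    (e : OpenPartialHomeomorph M (Cn N)) (z : Cn N) : Cn N →L[ℝ] Cn N →L[ℝ] (Fin n → ℝ) :=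
  LinearMap.toContinuousBilinearMap <|
    LinearMap.mk₂ ℝ (fun v w l => (Ql l).realForm (π l (e.symm z))
        (projDifferential π e l z v) (projDifferential π e l z w))
      (fun v v' w => by ext l; simp)
      (fun r v w => by
        ext l
        rw [← Complex.coe_smul r v, map_smul, Complex.coe_smul r]
        simp)
      (fun v w w' => by ext l; simp)
      (fun r v w => by
        ext l
        rw [← Complex.coe_smul r w, map_smul, Complex.coe_smul r]
        simp)

variable {Ql : ∀ l, HermitianMetric (m l) (X l)} {π : ∀ l, M → X l}
  {e : OpenPartialHomeomorph M (Cn N)}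

theorem splitForm_apply (z v w : Cn N) (l : Fin n) :
    splitForm Ql π e z v w l = (Ql l).realForm (π l (e.symm z))
        (projDifferential π e l z v) (projDifferential π e l z w) := rfl

variable {Q : HermitianMetric N M} (hπ : IsProductDecomposition Q Ql π)
  (he : IsHolomorphicChart N M e) {z : Cn N} (hz : z ∈ e.target)

include hπ he hz

theorem bijective_projDifferential : Function.Bijective
    fun (v : Cn N) (l : Fin n) => projDifferential (m := m) π e l z v :=
  (hπ.bijective_tangent (e.symm z)).comp (bijective_chartDifferential he hz)

theorem contMDiffAt_proj (l : Fin n) :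
    ContMDiffAt 𝓘(ℂ, Cn N) 𝓘(ℂ, Cn (m l)) ω (π l ∘ e.symm) z :=
  ((hπ.holomorphic l) (e.symm z)).comp z
    ((contMDiffOn_symm_of_mem_maximalAtlas he).contMDiffAt (e.open_target.mem_nhds hz))

theorem mfderiv_proj (l : Fin n) :
    mfderiv 𝓘(ℂ, Cn N) 𝓘(ℂ, Cn (m l)) (π l ∘ e.symm) z = projDifferential π e l z :=
  mfderiv_comp z (((hπ.holomorphic l) (e.symm z)).mdifferentiableAt (by simp))
    ((contMDiffAt_symm_of_mem_maximalAtlas he hz).mdifferentiableAt (by simp))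

variable [∀ l, IsManifold 𝓘(ℂ, Cn (m l)) ω (X l)]

/-- Here `f` is `π l` read in charts of `M` and of the factor. The identity holds on a neighbourhood
of `z`, so it can be differentiated there. -/
theorem splitForm_eq_pullback (l : Fin n) : ∃ (e' : OpenPartialHomeomorph (X l) (Cn (m l)))
    (f : Cn N → Cn (m l)), IsHolomorphicChart (m l) (X l) e' ∧ ContDiffAt ℂ ω f z ∧
      f z ∈ e'.target ∧ (∀ᶠ x in 𝓝 z, ∀ v w, splitForm Ql π e x v w l =
        (Ql l).chartForm e' (f x) (fderiv ℂ f x v) (fderiv ℂ f x w)) := by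
  set p := π l (e.symm z) with hp
  let e' := chartAt (Cn (m l)) p
  have he' : IsHolomorphicChart (m l) (X l) e' := IsManifold.chart_mem_maximalAtlas p
  have hp' : p ∈ e'.source := mem_chart_source (Cn (m l)) p
  have hmd := contMDiffAt_proj hπ he hz l
  let f : Cn N → Cn (m l) := e' ∘ (π l ∘ e.symm)
  have hf : ContDiffAt ℂ ω f z := by
    rw [← contMDiffAt_iff_contDiffAt]
    exact (contMDiffAt_of_mem_maximalAtlas he' hp').comp z hmd
  refine ⟨e', f, he', hf, e'.map_source hp', ?_⟩
  have hsrc : ∀ᶠ x in 𝓝 z, π l (e.symm x) ∈ e'.source :=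
    hmd.continuousAt.eventually (e'.open_source.mem_nhds hp')
  filter_upwards [hsrc.eventually_nhds, e.open_target.mem_nhds hz,
    hf.eventually (by simp)] with x hx hxe hfx v w
  have hx0 : π l (e.symm x) ∈ e'.source := hx.self_of_nhds
  have heq : (e'.symm ∘ f) =ᶠ[𝓝 x] π l ∘ e.symm := by
    filter_upwards [hx] with y hy using e'.left_inv hy
  have hD : projDifferential π e l x = (chartDifferential e' (f x)).comp (fderiv ℂ f x) := by
    rw [← mfderiv_proj hπ he hxe l, ← heq.mfderiv_eq]
    rw [mfderiv_comp x (he'.mdifferentiable.mdifferentiableAt_symm (e'.map_source hx0))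
      (hfx.differentiableAt (by simp)).mdifferentiableAt, mfderiv_eq_fderiv]
    rfl
  have hpt : e'.symm (f x) = π l (e.symm x) := e'.left_inv hx0
  rw [splitForm_apply, hD, HermitianMetric.chartForm_apply, hpt]
  rfl

end Decomposition

/-! ### The split form of a product and the geometry of `Ftk`. -/

section Decomposition

variable {n N : ℕ} {m : Fin n → ℕ}
  {M : Type*} [TopologicalSpace M] [ChartedSpace (Cn N) M]
  {X : Fin n → Type*} [∀ l, TopologicalSpace (X l)] [∀ l, ChartedSpace (Cn (m l)) (X l)]
  {Ql : ∀ l, HermitianMetric (m l) (X l)} {π : ∀ l, M → X l}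
  {e : OpenPartialHomeomorph M (Cn N)} {Q : HermitianMetric N M}

theorem fderiv_apply₂_apply {B : Cn N → Cn N →L[ℝ] Cn N →L[ℝ] (Fin n → ℝ)} {z : Cn N}
    (hB : DifferentiableAt ℝ B z) (e v w : Cn N) (l : Fin n) :
    fderiv ℝ (fun x => B x v w l) z e = fderiv ℝ B z e v w l := by
  have h := hasFDerivAt_pi'.1 (hasFDerivAt_apply₂ hB v w) l
  rw [h.fderiv]
  simp

theorem HermitianMetric.eq_zero_of_chartForm {e : OpenPartialHomeomorph M (Cn N)}
    (he : IsHolomorphicChart N M e) {z : Cn N} (hz : z ∈ e.target) {v : Cn N}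
    (hv : Q.chartForm e z v v = 0) : v = 0 := by
  by_contra h
  have h' : chartDifferential e z v ≠ 0 := fun h0 =>
    h ((bijective_chartDifferential he hz).1 (h0.trans (map_zero _).symm))
  exact (Q.realForm_pos (e.symm z) h').ne' hv

theorem splitForm_self_eq_zero {z d : Cn N} {l : Fin n} :
    splitForm Ql π e z d d l = 0 ↔ projDifferential (m := m) π e l z d = 0 := by
  rw [splitForm_apply]
  refine ⟨fun h => ?_, fun h => by rw [h]; simp⟩
  by_contra h'
  exact ((Ql l).realForm_pos _ h').ne' h

theorem isSplitForm_splitForm [∀ l, IsManifold 𝓘(ℂ, Cn (m l)) ω (X l)]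
    (hπ : IsProductDecomposition Q Ql π) (he : IsHolomorphicChart N M e) :
    IsSplitForm e.target (splitForm Ql π e) := by
  have hsmooth : ContDiffOn ℝ ∞ (splitForm Ql π e) e.target := by
    rw [contDiffOn_clm_apply]
    intro v
    rw [contDiffOn_clm_apply]
    intro w
    rw [contDiffOn_pi]
    intro l z hz
    obtain ⟨e', f, he', hf, hfz, hB⟩ := splitForm_eq_pullback hπ he hz l
    have hK : ContDiffAt ℝ ∞ ((Ql l).chartForm e') (f z) :=
      ((Ql l).contDiffOn_chartForm he').contDiffAt (e'.open_target.mem_nhds hfz)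
    refine ((contDiffAt_pullback hf hK v w).congr_of_eventuallyEq ?_).contDiffWithinAt
    filter_upwards [hB] with x hx using hx v w
  have hdiff : ∀ z ∈ e.target, DifferentiableAt ℝ (splitForm Ql π e) z := fun z hz =>
    (hsmooth.contDiffAt (e.open_target.mem_nhds hz)).differentiableAt (by simp)
  refine
    { isOpen := e.open_target
      smooth := hsmooth
      symm := fun z _ v w => ?_
      map_I := fun z _ v w => ?_
      nonneg := fun z _ v l => (Ql l).realForm_nonneg _ _
      definite := fun z hz v hv h => ?_
      split := fun z hz c l => ?_
      fderiv_self := fun z hz v d l hd => ?_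
      fderiv_I := fun z hz c v d l hd => ?_
      isometric := fun z hz z' hz' => ?_ }
  · ext l
    exact (Ql l).realForm_symm _ _ _
  · ext l
    rw [splitForm_apply, (projDifferential π e l z).map_smul, (projDifferential π e l z).map_smul,
      (Ql l).realForm_I, splitForm_apply]
  · refine hv ((bijective_projDifferential hπ he hz).1 (funext fun l => ?_))
    have h' : projDifferential π e l z v = 0 :=
      splitForm_self_eq_zero.1 (congrFun h l)
    simp only [h', map_zero]
  -- The vector `d` is the part of `c` tangent to the factor `l`.
  · obtain ⟨d, hd⟩ := (bijective_projDifferential hπ he hz).2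
      (Pi.single l (projDifferential π e l z c))
    refine ⟨d, ?_, fun j hj => ?_⟩
    · have h := congrFun hd l
      simp only [Pi.single_eq_same] at h
      rw [splitForm_self_eq_zero, map_sub, h, sub_self]
    · have h := congrFun hd j
      simp only [Pi.single_eq_of_ne hj] at h
      rw [splitForm_self_eq_zero, h]
  · obtain ⟨e', f, he', hf, hfz, hB⟩ := splitForm_eq_pullback hπ he hz l
    have hK : DifferentiableAt ℝ ((Ql l).chartForm e') (f z) :=
      (((Ql l).contDiffOn_chartForm he').contDiffAt
        (e'.open_target.mem_nhds hfz)).differentiableAt (by simp)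
    have hd' : fderiv ℂ f z d = 0 := (Ql l).eq_zero_of_chartForm he' hfz (by
      rw [← hB.self_of_nhds, hd])
    have h := fderiv_pullback_self hf hK (fun v w => (Ql l).realForm_symm _ _ _) (v := v) hd'
    have hev : ∀ v w, (fun x => splitForm Ql π e x v w l) =ᶠ[𝓝 z] fun x =>
        (Ql l).chartForm e' (f x) (fderiv ℂ f x v) (fderiv ℂ f x w) := fun v w => by
      filter_upwards [hB] with x hx using hx v w
    rw [← (hev v d).fderiv_eq, ← (hev v v).fderiv_eq, fderiv_apply₂_apply (hdiff z hz),
      fderiv_apply₂_apply (hdiff z hz)] at h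
    exact h
  · obtain ⟨e', f, he', hf, hfz, hB⟩ := splitForm_eq_pullback hπ he hz l
    have hK : DifferentiableAt ℝ ((Ql l).chartForm e') (f z) :=
      (((Ql l).contDiffOn_chartForm he').contDiffAt
        (e'.open_target.mem_nhds hfz)).differentiableAt (by simp)
    have hd' : fderiv ℂ f z d = 0 := (Ql l).eq_zero_of_chartForm he' hfz (by
      rw [← hB.self_of_nhds, hd])
    have h := fderiv_pullback_I hf hK (v := v) hd' c
    have hev : ∀ v w, (fun x => splitForm Ql π e x v w l) =ᶠ[𝓝 z] fun x =>
        (Ql l).chartForm e' (f x) (fderiv ℂ f x v) (fderiv ℂ f x w) := fun v w => by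
      filter_upwards [hB] with x hx using hx v w
    rw [← (hev v d).fderiv_eq, ← (hev v (Complex.I • d)).fderiv_eq,
      fderiv_apply₂_apply (hdiff z hz), fderiv_apply₂_apply (hdiff z hz)] at h
    exact h
  · have hE : ∀ z ∈ e.target, ∃ E : Cn N ≃ₗ[ℝ] (∀ l, Cn (m l)), ∀ v l,
        E v l = projDifferential π e l z v := fun z hz =>
      let D : Cn N →ₗ[ℝ] (∀ l, Cn (m l)) := LinearMap.pi fun l =>
        ((projDifferential π e l z).restrictScalars ℝ : Cn N →L[ℝ] Cn (m l)).toLinearMap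
      ⟨LinearEquiv.ofBijective D (bijective_projDifferential hπ he hz), fun v l => rfl⟩
    obtain ⟨E, hE₁⟩ := hE z hz
    obtain ⟨E', hE₂⟩ := hE z' hz'
    -- An isometry is chosen on each factor, and these are assembled through the product
    -- decompositions at `z` and `z'`; this preserves all components at once.
    choose T hT using fun l => exists_isometry ((Ql l).realForm (π l (e.symm z)))
      ((Ql l).realForm (π l (e.symm z'))) (fun v hv => (Ql l).realForm_pos _ hv)
      (fun v hv => (Ql l).realForm_pos _ hv)
    refine ⟨(E.trans (LinearEquiv.piCongrRight T)).trans E'.symm, fun w => ?_⟩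
    ext l
    have h : projDifferential π e l z' (((E.trans (LinearEquiv.piCongrRight T)).trans E'.symm) w) =
        T l (projDifferential π e l z w) := by
      rw [← hE₂, ← hE₁]
      simp
    rw [splitForm_apply, h, hT, splitForm_apply]

/-- The vector of the numbers `Q_l(π_l(p), (π_l)_* v)`. -/
def quadVector (Ql : ∀ l, HermitianMetric (m l) (X l)) (π : ∀ l, M → X l) (p : M)
    (v : TangentSpace 𝓘(ℂ, Cn N) p) (l : Fin n) : ℝ :=
  (Ql l).quad (π l p) (pushforward π l p v)

theorem quadVector_nonneg (p : M) (v : TangentSpace 𝓘(ℂ, Cn N) p) : 0 ≤ quadVector Ql π p v :=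
  fun l => (Ql l).realForm_nonneg _ _

theorem quadVector_eq_zero_iff (hπ : IsProductDecomposition Q Ql π) (p : M)
    (v : TangentSpace 𝓘(ℂ, Cn N) p) : quadVector Ql π p v = 0 ↔ v = 0 := by
  constructor
  · intro h
    refine (hπ.bijective_tangent p).1 (funext fun l => ?_)
    have h0 : pushforward (m := m) π l p 0 = 0 := map_zero (mfderiv 𝓘(ℂ, Cn N) 𝓘(ℂ, Cn (m l)) (π l) p)
    simp only [h0]
    by_contra h'
    exact ((Ql l).pos _ _ h').ne' (congrFun h l)
  · rintro rfl
    ext l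
    have h0 : pushforward (m := m) π l p 0 = 0 := map_zero (mfderiv 𝓘(ℂ, Cn N) 𝓘(ℂ, Cn (m l)) (π l) p)
    simp [quadVector, HermitianMetric.quad, h0]

theorem quadVector_smul (p : M) (c : ℂ) (v : TangentSpace 𝓘(ℂ, Cn N) p) :
    quadVector Ql π p (c • v) = ‖c‖ ^ 2 • quadVector Ql π p v := by
  ext l
  have h0 : pushforward (m := m) π l p (c • v) = c • pushforward π l p v :=
    map_smul (mfderiv 𝓘(ℂ, Cn N) 𝓘(ℂ, Cn (m l)) (π l) p) c v
  simp only [quadVector, HermitianMetric.quad, h0, Pi.smul_apply, smul_eq_mul]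
  rw [LinearMap.map_smulₛₗ, map_smul, LinearMap.smul_apply, smul_eq_mul, smul_eq_mul, ← mul_assoc,
    Complex.conj_mul', ← Complex.ofReal_pow, Complex.re_ofReal_mul]

theorem quadVector_chart (z v : Cn N) :
    quadVector Ql π (e.symm z) (tangentVector e z v) = splitForm Ql π e z v v := rfl

theorem Ftk_eq {t : ℝ} (ht : 0 ≤ t) (k : ℕ) (p : M) (v : TangentSpace 𝓘(ℂ, Cn N) p) :
    Ftk Ql π t k p v = √(powerGauge n t k (quadVector Ql π p v)) := by
  rw [powerGauge, Real.sqrt_mul (by positivity), Real.sqrt_div zero_le_one, Real.sqrt_one]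
  rfl

theorem Ftk_sq {t : ℝ} (ht : 0 ≤ t) {k : ℕ} (hk : 2 ≤ k) (p : M)
    (v : TangentSpace 𝓘(ℂ, Cn N) p) :
    Ftk Ql π t k p v ^ 2 = powerGauge n t k (quadVector Ql π p v) := by
  rw [Ftk_eq ht, Real.sq_sqrt (powerGauge_nonneg ht hk (quadVector_nonneg p v))]

theorem localSq_Ftk {t : ℝ} (ht : 0 ≤ t) {k : ℕ} (hk : 2 ≤ k) :
    localSq (Ftk Ql π t k) e = fun z w => powerGauge n t k (splitForm Ql π e z w w) := by
  funext z v
  rw [localSq, localRep, Ftk_sq ht hk, quadVector_chart]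

theorem form_eq_antilin (hπ : IsProductDecomposition Q Ql π) (z v w : Cn N) :
    Q.form (e.symm z) (tangentVector e z v) (tangentVector e z w) =
      antilin (fun d => sumGauge n (splitForm Ql π e z v d)) w := by
  rw [hπ.isometry]
  have h : ∀ l, (Ql l).form (π l (e.symm z)) (pushforward π l (e.symm z) (tangentVector e z v))
      (pushforward π l (e.symm z) (tangentVector e z w)) =
      antilin (fun d => splitForm Ql π e z v d l) w := fun l => by
    refine ((Ql l).form_eq _ _ _).trans ?_
    simp only [antilin, splitForm_apply, map_smul]
    rfl
  simp only [h, antilin, sumGauge_apply, Finset.sum_add_distrib, ← Finset.mul_sum,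
    Complex.ofReal_sum]

theorem localSq_norm (hπ : IsProductDecomposition Q Ql π) :
    localSq Q.norm e = fun z w => sumGauge n (splitForm Ql π e z w w) := by
  funext z v
  have h : Q.quad (e.symm z) (tangentVector e z v) =
      sumGauge n (splitForm Ql π e z v v) := by
    rw [HermitianMetric.quad, form_eq_antilin hπ]
    simp [antilin]
  rw [localSq, localRep, HermitianMetric.norm, h, Real.sq_sqrt]
  rw [sumGauge_apply]
  exact Finset.sum_nonneg fun l _ => (Ql l).realForm_nonneg _ _

variable [∀ l, IsManifold 𝓘(ℂ, Cn (m l)) ω (X l)] (hπ : IsProductDecomposition Q Ql π)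
  {t : ℝ} (ht : 0 ≤ t) {k : ℕ} (hk : 2 ≤ k)

include hπ ht hk

theorem isStronglyPseudoconvex_Ftk : IsStronglyPseudoconvex (Ftk (N := N) Ql π t k) where
  continuous e he := by
    have h : ∀ x : Cn N × Cn N, localRep (Ftk Ql π t k) e x.1 x.2 =
        √(powerGauge n t k (splitForm Ql π e x.1 x.2 x.2)) := fun x => Ftk_eq ht k _ _
    simp only [h]
    refine Real.continuous_sqrt.comp_continuousOn
      ((continuous_powerGauge t k).comp_continuousOn ?_)
    have hB : ContinuousOn (fun x : Cn N × Cn N => splitForm Ql π e x.1) (e.target ×ˢ univ) :=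
      (isSplitForm_splitForm hπ he).smooth.continuousOn.comp continuousOn_fst fun x hx => hx.1
    exact (hB.clm_apply continuousOn_snd).clm_apply continuousOn_snd
  nonneg p v := by
    rw [Ftk_eq ht]
    exact Real.sqrt_nonneg _
  eq_zero_iff p v := by
    rw [← quadVector_eq_zero_iff hπ, ← sq_eq_zero_iff, Ftk_sq ht hk]
    refine ⟨fun h => ?_, fun h => by rw [h, powerGauge_zero t hk]⟩
    by_contra h'
    exact (powerGauge_pos ht k (quadVector_nonneg p v) h').ne' h
  smooth e he := by
    rw [localSq_Ftk ht hk]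
    rintro ⟨z, v⟩ ⟨hz, hv⟩
    exact ((isSplitForm_splitForm hπ he).contDiffAt_comp_quad hz
      (isGauge_powerGauge ht hk) hv).contDiffWithinAt
  homogeneous p c v := by
    rw [Ftk_sq ht hk, Ftk_sq ht hk, quadVector_smul,
      powerGauge_smul t hk (sq_nonneg _) (quadVector_nonneg p v)]
  posDef e he z hz v hv := by
    rw [localSq_Ftk ht hk]
    exact (isSplitForm_splitForm hπ he).posDef_leviMatrix (isGauge_powerGauge ht hk) hz hv

theorem isStronglyConvex_Ftk : IsStronglyConvex (Ftk (N := N) Ql π t k) where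
  stronglyPseudoconvex := isStronglyPseudoconvex_Ftk hπ ht hk
  posDef e he z hz v hv := by
    rw [localSq_Ftk ht hk]
    exact (isSplitForm_splitForm hπ he).posDef_fundamentalTensor (isGauge_powerGauge ht hk) hz hv

theorem isComplexBerwald_Ftk : IsComplexBerwald (Ftk (N := N) Ql π t k) where
  stronglyPseudoconvex := isStronglyPseudoconvex_Ftk hπ ht hk
  independent e he z hz v w hv hw α ν μ := by
    rw [localSq_Ftk ht hk]
    exact (isSplitForm_splitForm hπ he).chernFinsler_eq hz (isGauge_powerGauge ht hk) hv hw α ν μ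

theorem isKahlerFinsler_Ftk (hQ : Q.IsKahler) : IsKahlerFinsler (Ftk (N := N) Ql π t k) where
  stronglyPseudoconvex := isStronglyPseudoconvex_Ftk hπ ht hk
  torsion e he z hz v hv α μ := by
    have hB := isSplitForm_splitForm hπ he
    rw [localSq_Ftk ht hk]
    refine Finset.sum_eq_zero fun ν _ => ?_
    -- The Kähler condition makes the coefficients symmetric in `ν` and `μ`, so the torsion vanishes
    -- term by term.
    have hsymm : ∀ τ, mixedLeviForm (sumGauge n) (splitForm Ql π e z)
        (fderiv ℝ (splitForm Ql π e) z) (realBasis (Sum.inl μ)) (realBasis (Sum.inl ν))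
        (realBasis (Sum.inl τ)) =
        mixedLeviForm (sumGauge n) (splitForm Ql π e z)
        (fderiv ℝ (splitForm Ql π e) z) (realBasis (Sum.inl ν)) (realBasis (Sum.inl μ))
        (realBasis (Sum.inl τ)) := fun τ => by
      have hc : ∀ α β x, Q.coeff e α β x = antilin (fun d => sumGauge n
          (splitForm Ql π e x (realBasis (Sum.inl α)) d)) (realBasis (Sum.inl β)) :=
        fun α β x => form_eq_antilin hπ _ _ _
      rw [← hB.dHol_hermitian hz (hc ν τ) μ, ← hB.dHol_hermitian hz (hc μ τ) ν]
      exact hQ e he z hz ν τ μ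
    rw [hB.chernFinsler_gauge (isGauge_powerGauge ht hk) hz hv,
      hB.chernFinsler_gauge (isGauge_powerGauge ht hk) hz hv,
      hB.chernFinsler_sumGauge hz hv, hB.chernFinsler_sumGauge hz hv]
    simp only [hsymm, sub_self, zero_mul]

theorem isRealBerwald_Ftk : IsRealBerwald (Ftk (N := N) Ql π t k) where
  stronglyConvex := isStronglyConvex_Ftk hπ ht hk
  independent e he z hz v w hv hw b a c := by
    rw [localSq_Ftk ht hk]
    exact (isSplitForm_splitForm hπ he).realBerwaldCoeff_eq hz (isGauge_powerGauge ht hk) hv hw b a c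

theorem hasVanishingSCurvature_Ftk : HasVanishingSCurvature (Ftk (N := N) Ql π t k) := by
  intro e he z hz v hv
  rw [localSq_Ftk ht hk]
  exact (isSplitForm_splitForm hπ he).sCurvature_eq_zero (isGauge_powerGauge ht hk) hz hv

/-- The sprays of `Ftk` and of `√Q` are known to agree at nonzero vectors; `regular` guarantees that
the velocity is one. -/
theorem isGeodesicOn_Ftk_iff (γ : ℝ → M) (s : Set ℝ) :
    IsGeodesicOn (Ftk (N := N) Ql π t k) γ s ↔ IsGeodesicOn Q.norm γ s := by
  have h : ∀ e, IsHolomorphicChart N M e → ∀ z ∈ e.target, ∀ v, v ≠ 0 →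
      sprayVector (localSq (Ftk Ql π t k) e) z v = sprayVector (localSq Q.norm e) z v := by
    intro e he z hz v hv
    rw [localSq_Ftk ht hk, localSq_norm hπ]
    exact (isSplitForm_splitForm hπ he).sprayVector_gauge (isGauge_powerGauge ht hk) hz hv
  constructor
  · intro hγ
    refine ⟨hγ.continuousOn, hγ.smooth, hγ.regular, fun e he r hr hre => ?_⟩
    rw [← h e he _ (e.map_source hre) _ (hγ.regular e he r hr hre)]
    exact hγ.equation e he r hr hre
  · intro hγ
    refine ⟨hγ.continuousOn, hγ.smooth, hγ.regular, fun e he r hr hre => ?_⟩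
    rw [h e he _ (e.map_source hre) _ (hγ.regular e he r hr hre)]
    exact hγ.equation e he r hr hre

theorem isCompleteMetric_Ftk (hQ : Q.IsComplete) : IsCompleteMetric (Ftk (N := N) Ql π t k) := by
  intro γ s hs hs' hs'' hγ
  obtain ⟨γ', h, h'⟩ := hQ γ s hs hs' hs'' ((isGeodesicOn_Ftk_iff hπ ht hk γ s).1 hγ)
  exact ⟨γ', (isGeodesicOn_Ftk_iff hπ ht hk γ' univ).2 h, h'⟩

end Decomposition

/-! ### Infinitely many distinct metrics. -/

theorem powerGauge_two_injective {n : ℕ} (hn : 2 ≤ n) {x : Fin n → ℝ} (hx : ∀ l, 0 < x l)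
    {s t : ℝ} (hs : 0 ≤ s) (ht : 0 ≤ t) (h : powerGauge n s 2 x = powerGauge n t 2 x) :
    s = t := by
  have hlt : ∀ l, x l < ∑ j, x j := fun l => by
    have : Nontrivial (Fin n) := Fin.nontrivial_iff_two_le.2 hn
    obtain ⟨j, hj⟩ := exists_ne l
    exact Finset.single_lt_sum hj (Finset.mem_univ l) (Finset.mem_univ j) (hx j)
      fun i _ _ => (hx i).le
  have hsq : ∑ l, x l ^ 2 < (∑ l, x l) ^ 2 := by
    rw [sq, Finset.sum_mul]
    refine Finset.sum_lt_sum_of_nonempty ⟨⟨0, by omega⟩, Finset.mem_univ _⟩ fun l _ => ?_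
    rw [sq]
    exact mul_lt_mul_of_pos_left (hlt l) (hx l)
  -- With at least two positive coordinates the `ℓ²` norm is strictly smaller than the `ℓ¹` norm, so
  -- the weighted mean `(ℓ¹ + t ℓ²)/(1 + t)` determines `t`.
  have hroot : (∑ l, x l ^ 2) ^ (1 / ((2 : ℕ) : ℝ)) < ∑ l, x l := by
    have h2 : (1 / ((2 : ℕ) : ℝ)) = 1 / 2 := by norm_num
    rw [h2, ← Real.sqrt_eq_rpow]
    exact (Real.sqrt_lt' (Finset.sum_pos (fun l _ => hx l)
      ⟨⟨0, by omega⟩, Finset.mem_univ _⟩)).2 hsq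
  simp only [powerGauge] at h
  have h1 : (1 + s) ≠ 0 := by positivity
  have h2 : (1 + t) ≠ 0 := by positivity
  field_simp at h
  have h3 : (s - t) * ((∑ l, x l) - (∑ l, x l ^ 2) ^ (1 / ((2 : ℕ) : ℝ))) = 0 := by
    linear_combination -h
  rcases mul_eq_zero.1 h3 with h4 | h4 <;> linarith

theorem infinite_setOf_Ftk {n N : ℕ} (hn : 2 ≤ n) {m : Fin n → ℕ} (hm : ∀ l, 1 ≤ m l)
    {M : Type*} [TopologicalSpace M] [ChartedSpace (Cn N) M] [Nonempty M]
    {X : Fin n → Type*} [∀ l, TopologicalSpace (X l)] [∀ l, ChartedSpace (Cn (m l)) (X l)]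
    {Q : HermitianMetric N M} {Ql : ∀ l, HermitianMetric (m l) (X l)} {π : ∀ l, M → X l}
    (hπ : IsProductDecomposition Q Ql π) :
    {F : TangentFunction N M |
      ∃ (t : ℝ) (k : ℕ), 0 ≤ t ∧ 2 ≤ k ∧ F = Ftk Ql π t k}.Infinite := by
  obtain ⟨p⟩ := ‹Nonempty M›
  refine Set.infinite_of_injective_forall_mem (f := fun j : ℕ => Ftk Ql π (j : ℝ) 2) ?_
    fun j => ⟨j, 2, Nat.cast_nonneg j, le_rfl, rfl⟩
  intro i j hij
  -- A vector whose projections to all factors are nonzero, which is possible because the factors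
  -- have positive dimension.
  obtain ⟨v, hv⟩ := (hπ.bijective_tangent p).2 fun l => (fun _ => 1 : Cn (m l))
  have hpos : ∀ l, 0 < quadVector Ql π p v l := fun l => by
    refine (Ql l).pos _ _ ?_
    rw [show pushforward π l p v = (fun _ => 1 : Cn (m l)) from congrFun hv l]
    intro h0
    exact one_ne_zero (congrFun h0 ⟨0, hm l⟩)
  have h := congrArg (fun F : TangentFunction N M => F p v ^ 2) hij
  simp only [Ftk_sq (Nat.cast_nonneg _) le_rfl] at h
  exact_mod_cast powerGauge_two_injective hn hpos (Nat.cast_nonneg i) (Nat.cast_nonneg j) h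

end CFinsler

end

theorem mainTheorem3 {n N : ℕ} (hn : 2 ≤ n) {m : Fin n → ℕ} (hm : ∀ l, 1 ≤ m l)
    {M : Type*} [TopologicalSpace M] [T2Space M] [SecondCountableTopology M]
    [ChartedSpace (CFinsler.Cn N) M] [IsManifold 𝓘(ℂ, CFinsler.Cn N) ω M]
    [SimplyConnectedSpace M]
    {X : Fin n → Type*} [∀ l, TopologicalSpace (X l)]
    [∀ l, ChartedSpace (CFinsler.Cn (m l)) (X l)]
    [∀ l, IsManifold 𝓘(ℂ, CFinsler.Cn (m l)) ω (X l)]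
    (Q : CFinsler.HermitianMetric N M) (hQ : Q.IsComplete)
    (Ql : ∀ l, CFinsler.HermitianMetric (m l) (X l)) (π : ∀ l, M → X l)
    (hπ : CFinsler.IsProductDecomposition Q Ql π) :
    (∀ (t : ℝ) (k : ℕ), 0 ≤ t → 2 ≤ k →
      CFinsler.IsStronglyConvex (CFinsler.Ftk (N := N) Ql π t k) ∧
      CFinsler.IsCompleteMetric (CFinsler.Ftk (N := N) Ql π t k) ∧
      CFinsler.IsComplexBerwald (CFinsler.Ftk (N := N) Ql π t k) ∧
      (Q.IsKahler → CFinsler.IsKahlerBerwald (CFinsler.Ftk (N := N) Ql π t k)) ∧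
      CFinsler.IsRealBerwald (CFinsler.Ftk (N := N) Ql π t k) ∧
      CFinsler.HasVanishingSCurvature (CFinsler.Ftk (N := N) Ql π t k)) ∧
    {F : CFinsler.TangentFunction N M |
      ∃ (t : ℝ) (k : ℕ), 0 ≤ t ∧ 2 ≤ k ∧ F = CFinsler.Ftk Ql π t k}.Infinite := by
  have : Nonempty M := (inferInstance : PathConnectedSpace M).nonempty
  refine ⟨fun t k ht hk => ⟨CFinsler.isStronglyConvex_Ftk hπ ht hk,
    CFinsler.isCompleteMetric_Ftk hπ ht hk hQ, CFinsler.isComplexBerwald_Ftk hπ ht hk,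
    fun hK => ⟨CFinsler.isKahlerFinsler_Ftk hπ ht hk hK, CFinsler.isComplexBerwald_Ftk hπ ht hk⟩,
    CFinsler.isRealBerwald_Ftk hπ ht hk, CFinsler.hasVanishingSCurvature_Ftk hπ ht hk⟩,
    CFinsler.infinite_setOf_Ftk hn hm hπ⟩
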